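/- Let $A^1,\dots,A^n\subset\mathbb E^m$ be closed convex sets whose boundaries $\partial A^i$ are smooth hypersurfaces, and consider the billiard table $$T=\overline{\mathbb E^m\setminus\bigcup_i A^i}$$ with the walls $A^1,\dots,A^n$. A closed convex set $A\subset\mathbb E^m$ is said to have $\varepsilon$-wide corners if together with each point $p$ it contains a small right circular cone with tip at $p$ and aperture $\varepsilon$ (that is, $\varepsilon$ is the maximal angle between two generating lines of the cone). A billiard trajectory on $T$ is a unit-speed broken line in $T$, parametrized by an interval of any kind, with break points locally finite in this interval, such that at each break point it lies on exactly one wall $A^i$, at a point of $\partial A^i$, and is reflected there by the standard law of billiards: the outgoing velocity is the mirror image of the incoming velocity in the tangent hyperplane of $\partial A^i$. The break points (counted by their times) are called collisions. **Theorem.** Let $\varepsilon>0$. Assume that $A^1,\dots,A^n$ have a common interior point and that for every $F\subset\{1,\dots,n\}$ the intersection $\bigcap_{i\in F}A^i$ has $\varepsilon$-wide corners. Then the number of collisions of any billiard trajectory on $T$ is at most a number $N$ which depends only on $n$ and $\varepsilon$; explicitly, one can take $$N=\left(\left\lceil\tfrac{\pi}{\varepsilon}\right\rceil+1\right)^{n^2}.$$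 -/

import Mathlib

open Set Filter Topology
open scoped ContDiff

namespace Billiards

/-- The Euclidean space `𝔼^m`. -/
abbrev Euc (m : ℕ) : Type := EuclideanSpace ℝ (Fin m)

/-! ### Wide corners -/

/-- The right circular cone with tip `p`, axis in the direction `v`, aperture `ε` and
slant height `r`.  The generating lines make the angle `ε / 2` with the axis, so that the maximal
angle between two of them is `ε`. -/
def rightCircularCone {m : ℕ} (p v : Euc m) (ε r : ℝ) : Set (Euc m) :=
  {x | x = p ∨ (dist x p ≤ r ∧ InnerProductGeometry.angle v (x - p) ≤ ε / 2)}

/-- `A` contains, together with each of its points `p`, a small right circular cone with tip `p`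
and aperture `ε`. -/
def HasWideCorners {m : ℕ} (ε : ℝ) (A : Set (Euc m)) : Prop :=
  ∀ p ∈ A, ∃ v : Euc m, v ≠ 0 ∧ ∃ r : ℝ, 0 < r ∧ rightCircularCone p v ε r ⊆ A

/-- The intersection of every subcollection of the `A i` has `ε`-wide corners. -/
def AllIntersectionsHaveWideCorners {m n : ℕ} (ε : ℝ) (A : Fin n → Set (Euc m)) : Prop :=
  ∀ F : Finset (Fin n), HasWideCorners ε (⋂ i ∈ F, A i)

/-! ### Walls with smooth boundary -/

/-- `f` is a smooth local equation of `S` around `p` that is regular at `p`. -/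
def IsLocalEquation {m : ℕ} (S : Set (Euc m)) (p : Euc m) (f : Euc m → ℝ) : Prop :=
  ∃ U : Set (Euc m), IsOpen U ∧ p ∈ U ∧ ContDiffOn ℝ ∞ f U ∧ fderiv ℝ f p ≠ 0 ∧
    S ∩ U = {x ∈ U | f x = 0}

/-- `S` is a smooth (embedded) hypersurface: near each of its points it is the zero set of a
smooth function with nonzero differential. -/
def IsSmoothHypersurface {m : ℕ} (S : Set (Euc m)) : Prop :=
  ∀ p ∈ S, ∃ f : Euc m → ℝ, IsLocalEquation S p f

/-- A convex wall: a closed convex set whose boundary is a smooth hypersurface. -/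
structure IsConvexWall {m : ℕ} (A : Set (Euc m)) : Prop where
  isClosed : IsClosed A
  convex : Convex ℝ A
  smooth : IsSmoothHypersurface (frontier A)

/-- The billiard table with walls `A i`: the closure of the complement of the union. -/
def table {m n : ℕ} (A : Fin n → Set (Euc m)) : Set (Euc m) :=
  closure (⋃ i, A i)ᶜ

/-! ### Trajectories -/

/-- Just before the time `t`, the curve `γ` moves along a straight line with velocity `u`
and arrives at `γ t`. -/
def HasVelocityBefore {m : ℕ} (γ : ℝ → Euc m) (t : ℝ) (u : Euc m) : Prop :=
  ∀ᶠ s in 𝓝[<] t, γ s = γ t + (s - t) • u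

/-- Just after the time `t`, the curve `γ` moves from `γ t` along a straight line with
velocity `v`. -/
def HasVelocityAfter {m : ℕ} (γ : ℝ → Euc m) (t : ℝ) (v : Euc m) : Prop :=
  ∀ᶠ s in 𝓝[>] t, γ s = γ t + (s - t) • v

/-- `γ` restricted to the interval `I` is a unit-speed broken line.  The condition makes `γ`
continuous on `I`, and its break points locally finite in `I`. -/
structure IsUnitSpeedBrokenLine {m : ℕ} (γ : ℝ → Euc m) (I : Set ℝ) : Prop where
  ordConnected : I.OrdConnected
  before : ∀ t ∈ I, (∃ s ∈ I, s < t) → ∃ u : Euc m, ‖u‖ = 1 ∧ HasVelocityBefore γ t u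
  after : ∀ t ∈ I, (∃ s ∈ I, t < s) → ∃ v : Euc m, ‖v‖ = 1 ∧ HasVelocityAfter γ t v

/-- The velocity `v` is obtained from `u` by the law of reflection in the hypersurface `S` at its
point `p`: it is the mirror image of `u` in the tangent hyperplane of `S` at `p`, which is the
kernel of the differential of a local equation of `S`. -/
def IsReflectedAt {m : ℕ} (S : Set (Euc m)) (p u v : Euc m) : Prop :=
  p ∈ S ∧ ∃ f : Euc m → ℝ, IsLocalEquation S p f ∧
    v = (LinearMap.ker (fderiv ℝ f p : Euc m →ₗ[ℝ] ℝ)).reflection u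

/-- The times of the collisions, that is, of the break points of `γ` on the interval `I`. -/
def collisionTimes {m : ℕ} (γ : ℝ → Euc m) (I : Set ℝ) : Set ℝ :=
  {t | t ∈ interior I ∧ ∃ u v : Euc m, HasVelocityBefore γ t u ∧ HasVelocityAfter γ t v ∧ u ≠ v}

/-- `γ` restricted to the interval `I` is a billiard trajectory on the table with walls `A i`:
a unit-speed broken line in the table which meets exactly one wall at each of its break points and
is reflected there in the boundary of this wall. -/
structure IsTrajectory {m n : ℕ} (A : Fin n → Set (Euc m)) (γ : ℝ → Euc m) (I : Set ℝ) :
    Prop where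
  brokenLine : IsUnitSpeedBrokenLine γ I
  mem_table : ∀ t ∈ I, γ t ∈ table A
  reflected : ∀ t ∈ collisionTimes γ I, ∃ i : Fin n, (∀ j, j ≠ i → γ t ∉ A j) ∧
    ∀ u v : Euc m, HasVelocityBefore γ t u → HasVelocityAfter γ t v →
      IsReflectedAt (frontier (A i)) (γ t) u v

end Billiards

/-! Put B = `⌈π / ε⌉₊ + 1`. Two comparisons of length contradict each other when there are too many
collisions.

Shortening. Given walls X, Y and end points x, y, minimise |xq| + |qy| over q in X ∩ Y. At the
minimiser z, with unit vectors ξ, η towards x, y, the vector ξ + η is normal to X ∩ Y, so it is α +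
β with α, β normal to X, Y. The wide corner at z bounds the angle of α and β by π - ε, so B
alternate steps along α and β lead from -ξ to η inside the unit ball (`exists_staircase`). Pairing
the segments of a broken line having B vertices alternately in X and Y with the stages of this walk
shows that its length is at least |xz| + |zy| (`compresses_alternating`). Substitution of words
extends this to s walls, with a word of length at most B^(s-1) (`IsWideFamily.exists_compresses`).

Minimality. If q lies in all the walls hit, the trajectory, prolonged by unit segments, is no longer
than the line through q with the same ends, and equality forces q to be the first collision point
(`IsCollisionChain.eq_of_dist_add_dist_le`).

Induction on the number s of walls (`IsCollisionChain.lt_pow`): a block of B^((s-1)^2) collisions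
hits every wall, so B^(s-1) blocks contain the compressing word. The resulting q is then the first
collision point and lies on all the walls, which is excluded for s ≥ 2. -/

namespace Billiards

open scoped RealInnerProductSpace

/-! ### Alternating walks in the unit ball -/

section Staircase

variable {E : Type*} [NormedAddCommGroup E] [InnerProductSpace ℝ E]

/-- One can walk inside the unit ball from `v` to `w` in `n` steps (possibly of length zero)
which go alternately in the directions `a` and `b`, the first one in the direction `a`. -/
def Staircase : ℕ → E → E → E → E → Prop
  | 0, _, _, v, w => v = w
  | n + 1, a, b, v, w => ∃ c : ℝ, 0 ≤ c ∧ ‖v + c • a‖ ≤ 1 ∧ Staircase n b a (v + c • a) w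

theorem Staircase.refl (n : ℕ) (a b : E) {v : E} (hv : ‖v‖ ≤ 1) : Staircase n a b v v := by
  induction n generalizing a b with
  | zero => rfl
  | succ n ih => exact ⟨0, le_rfl, by simpa using hv, by simpa using ih b a⟩

theorem Staircase.smul {n : ℕ} {a b v w : E} {r s : ℝ} (hr : 0 < r) (hs : 0 < s)
    (h : Staircase n (r • a) (s • b) v w) : Staircase n a b v w := by
  induction n generalizing a b v r s with
  | zero => exact h
  | succ n ih =>
    obtain ⟨c, hc, hb, hst⟩ := h
    rw [smul_smul] at hb hst
    exact ⟨c * r, by positivity, hb, ih hs hr hst⟩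

theorem norm_add_smul_le_one {v a : E} {c l : ℝ} (hc : 0 ≤ c) (hcl : c ≤ l) (hv : ‖v‖ ≤ 1)
    (hl : ‖v + l • a‖ ≤ 1) : ‖v + c • a‖ ≤ 1 := by
  rcases hc.eq_or_lt with rfl | hc
  · simpa using hv
  have hl0 : 0 < l := hc.trans_le hcl
  have h := (convex_closedBall (0 : E) 1) (x := v) (by simpa using hv) (y := v + l • a)
    (by simpa using hl) (a := 1 - c / l) (b := c / l)
    (by rw [sub_nonneg, div_le_one hl0]; exact hcl) (by positivity) (by ring)
  have e : (1 - c / l) • v + (c / l) • (v + l • a) = v + c • a := by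
    rw [smul_add, smul_smul, div_mul_cancel₀ _ hl0.ne']
    module
  rw [e] at h
  simpa using h

open Real in
-- The chord between the parameters φ₁ and φ₂ of the circle has direction angle (φ₁ + φ₂) / 2. If ψ
-- ≤ h, the corner of the triangle over the target chord lies on the chord drawn from the start in
-- the first direction, and two steps suffice. Otherwise the first step runs along that whole chord,
-- and a mirror image restores the situation with ψ - h and π - τ in place of τ and h: the quantity
-- h - τ, at most π, has grown by π - ψ.
theorem staircase_arc (n : ℕ) (e₁ e₂ c : E) (ρ A ψ τ h : ℝ) (hρ : 0 ≤ ρ)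
    (hball : ∀ φ : ℝ, ‖c + ρ • (sin φ • e₁ - cos φ • e₂)‖ ≤ 1)
    (hψ0 : 0 < ψ) (hψ : ψ < π) (hτ0 : 0 ≤ τ) (hτψ : τ ≤ ψ) (hτh : τ ≤ h) (hh : h ≤ π)
    (hn : π ≤ h - τ + n * (π - ψ)) :
    Staircase (n + 1) (cos A • e₁ + sin A • e₂) (cos (A + ψ) • e₁ + sin (A + ψ) • e₂)
      (c + ρ • (sin (A + τ - h) • e₁ - cos (A + τ - h) • e₂))
      (c + ρ • (sin (A + τ + h) • e₁ - cos (A + τ + h) • e₂)) := by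
  have chord : (c + ρ • (sin (A + τ - h) • e₁ - cos (A + τ - h) • e₂)) +
      (2 * ρ * sin (h - τ)) • (cos A • e₁ + sin A • e₂) =
      c + ρ • (sin (A + (h - τ)) • e₁ - cos (A + (h - τ)) • e₂) := by
    have : A + τ - h = A - (h - τ) := by ring
    rw [this, sin_sub A, cos_sub A, sin_add A, cos_add A]
    module
  have hs0 : 0 ≤ sin (h - τ) := sin_nonneg_of_nonneg_of_le_pi (by linarith) (by linarith)
  induction n generalizing e₂ A τ h with
  | zero =>
    -- Here h - τ = π, so that the two end points coincide.
    have h1 : h = π := by simp at hn; linarith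
    have h2 : τ = 0 := by simp at hn; linarith
    subst h1 h2
    have : A + 0 - π = A + 0 + π - 2 * π := by ring
    rw [this, sin_sub_two_pi, cos_sub_two_pi]
    exact Staircase.refl _ _ _ (hball _)
  | succ n ih =>
    by_cases hψh : ψ ≤ h
    · have hsψ : 0 < sin ψ := sin_pos_of_pos_of_lt_pi hψ0 hψ
      have hsh : 0 ≤ sin h := sin_nonneg_of_nonneg_of_le_pi (by linarith) hh
      have hsτ : 0 ≤ sin τ := sin_nonneg_of_nonneg_of_le_pi hτ0 (by linarith)
      have hsd : 0 ≤ sin (ψ - τ) := sin_nonneg_of_nonneg_of_le_pi (by linarith) (by linarith)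
      have hse : 0 ≤ sin (h - ψ) := sin_nonneg_of_nonneg_of_le_pi (by linarith) (by linarith)
      -- The sides of the triangle come from the law of sines; this identity shows that the first
      -- one fits into the chord.
      have key : sin (h - τ) * sin ψ - sin h * sin (ψ - τ) = sin (h - ψ) * sin τ := by
        rw [sin_sub, sin_sub, sin_sub]; ring
      refine ⟨2 * ρ * sin h * sin (ψ - τ) / sin ψ, by positivity, ?_, ?_⟩
      · refine norm_add_smul_le_one (l := 2 * ρ * sin (h - τ)) (by positivity) ?_ (hball _) ?_
        · rw [div_le_iff₀ hsψ]
          have : 0 ≤ ρ * (sin (h - ψ) * sin τ) := by positivity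
          rw [← key] at this
          linarith
        · rw [chord]; exact hball _
      · have e : (c + ρ • (sin (A + τ - h) • e₁ - cos (A + τ - h) • e₂)) +
            (2 * ρ * sin h * sin (ψ - τ) / sin ψ) • (cos A • e₁ + sin A • e₂) +
            (2 * ρ * sin h * sin τ / sin ψ) • (cos (A + ψ) • e₁ + sin (A + ψ) • e₂) =
            c + ρ • (sin (A + τ + h) • e₁ - cos (A + τ + h) • e₂) := by
          have hx : sin (ψ - τ) * cos A + sin τ * cos (A + ψ) = sin ψ * cos (A + τ) := by
            rw [sin_sub, cos_add, cos_add]; ring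
          have hy : sin (ψ - τ) * sin A + sin τ * sin (A + ψ) = sin ψ * sin (A + τ) := by
            rw [sin_sub, sin_add, sin_add]; ring
          have h1 : (2 * ρ * sin h * sin (ψ - τ) / sin ψ) • (cos A • e₁ + sin A • e₂) +
            (2 * ρ * sin h * sin τ / sin ψ) • (cos (A + ψ) • e₁ + sin (A + ψ) • e₂) =
            (2 * ρ * sin h / sin ψ) • ((sin (ψ - τ) * cos A + sin τ * cos (A + ψ)) • e₁ +
              (sin (ψ - τ) * sin A + sin τ * sin (A + ψ)) • e₂) := by module
          rw [add_assoc, h1, hx, hy, mul_smul, mul_smul (sin ψ), ← smul_add, smul_smul,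
            div_mul_cancel₀ _ hsψ.ne', sin_sub (A + τ), cos_sub (A + τ), sin_add (A + τ),
            cos_add (A + τ)]
          module
        exact ⟨2 * ρ * sin h * sin τ / sin ψ, by positivity, by rw [e]; exact hball _,
          by rw [e]; exact Staircase.refl _ _ _ (hball _)⟩
    · push Not at hψh
      refine ⟨2 * ρ * sin (h - τ), by positivity, by rw [chord]; exact hball _, ?_⟩
      rw [chord]
      have flip : ∀ φ : ℝ, sin (π - φ) • e₁ - cos (π - φ) • e₂ =
          sin φ • e₁ - cos φ • (-e₂) := by
        intro φ; rw [sin_pi_sub, cos_pi_sub]; module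
      have := ih (-e₂) (-A - ψ) (ψ - h) (π - τ)
        (fun φ => by rw [← flip]; exact hball _) (by linarith) (by linarith) (by linarith)
        (by linarith) (by push_cast at hn; linarith)
        (by
          have e : -A - ψ + (ψ - h) - (π - τ) = -A - ψ - (π - τ - (ψ - h)) := by ring
          rw [e, sin_sub (-A - ψ), cos_sub (-A - ψ), sin_add (-A - ψ), cos_add (-A - ψ)]
          module)
        (sin_nonneg_of_nonneg_of_le_pi (by linarith) (by linarith))
      rw [← flip, ← flip] at this
      convert this using 1
      · have : -A - ψ = -(A + ψ) := by ring
        rw [this, cos_neg, sin_neg]; module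
      · have : -A - ψ + ψ = -A := by ring
        rw [this, cos_neg, sin_neg]; module
      · have : π - (-A - ψ + (ψ - h) - (π - τ)) = A + (h - τ) + 2 * π := by ring
        rw [this, sin_add_two_pi, cos_add_two_pi]
      · have : π - (-A - ψ + (ψ - h) + (π - τ)) = A + τ + h := by ring
        rw [this]

theorem exists_polar {x y ρ : ℝ} (hρ : 0 ≤ ρ) (hy : 0 ≤ y) (h : x ^ 2 + y ^ 2 = ρ ^ 2) :
    ∃ τ : ℝ, 0 ≤ τ ∧ τ ≤ Real.pi ∧ x = ρ * Real.cos τ ∧ y = ρ * Real.sin τ := by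
  rcases hρ.eq_or_lt with rfl | hρ
  · refine ⟨0, le_rfl, Real.pi_pos.le, ?_, ?_⟩ <;> nlinarith
  have hle : |x| ≤ ρ := abs_le_of_sq_le_sq (by nlinarith) hρ.le
  obtain ⟨h1, h2⟩ := abs_le.1 hle
  refine ⟨Real.arccos (x / ρ), Real.arccos_nonneg _, Real.arccos_le_pi _, ?_, ?_⟩
  · rw [Real.cos_arccos, mul_div_cancel₀ _ hρ.ne']
    · rw [le_div_iff₀ hρ]; linarith
    · rw [div_le_one hρ]; exact h2
  · rw [Real.sin_arccos]
    have : 1 - (x / ρ) ^ 2 = (y / ρ) ^ 2 := by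
      field_simp; linarith
    rw [this, Real.sqrt_sq (by positivity), mul_div_cancel₀ _ hρ.ne']

open Real InnerProductGeometry in
-- The plane through `v` parallel to `α` and `β` cuts the unit sphere in a circle through `v` and
-- `w`, to which `staircase_arc` applies.
theorem exists_staircase {n : ℕ} {α β v w : E} {a b : ℝ} (hα : ‖α‖ = 1) (hβ : ‖β‖ = 1)
    (hv : ‖v‖ = 1) (hw : ‖w‖ = 1) (ha : 0 ≤ a) (hb : 0 ≤ b) (hvw : w = v + (a • α + b • β))
    (h0 : 0 < angle α β) (hπ : angle α β < π) (hn : π ≤ n * (π - angle α β)) :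
    Staircase (n + 1) α β v w := by
  by_cases hne : v = w
  · rw [← hne]; exact Staircase.refl _ _ _ hv.le
  set ψ := angle α β with hψ
  have hsψ : 0 < sin ψ := sin_pos_of_pos_of_lt_pi h0 hπ
  have hαβ : ⟪α, β⟫ = cos ψ := by
    rw [hψ, cos_angle, hα, hβ]; simp
  have hαα : ⟪α, α⟫ = 1 := by rw [real_inner_self_eq_norm_sq, hα]; norm_num
  have hββ : ⟪β, β⟫ = 1 := by rw [real_inner_self_eq_norm_sq, hβ]; norm_num
  have hsc : sin ψ ^ 2 + cos ψ ^ 2 = 1 := sin_sq_add_cos_sq ψ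
  obtain ⟨e, hβe, hαe, hee⟩ : ∃ e : E, β = cos ψ • α + sin ψ • e ∧ ⟪α, e⟫ = 0 ∧ ⟪e, e⟫ = 1 := by
    refine ⟨(sin ψ)⁻¹ • (β - cos ψ • α), ?_, ?_, ?_⟩
    · rw [smul_smul, mul_inv_cancel₀ hsψ.ne']; module
    · rw [inner_smul_right, inner_sub_right, inner_smul_right, hαβ, hαα]; ring
    · rw [inner_smul_right, inner_smul_left, inner_sub_right, inner_sub_left, inner_sub_left,
        inner_smul_right, inner_smul_left, inner_smul_left, inner_smul_right, real_inner_comm α β,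
        hαβ, hαα, hββ]
      simp only [conj_trivial]
      field_simp
      linarith
  set l := ‖w - v‖ with hl
  have hl0 : 0 < l := norm_pos_iff.2 (sub_ne_zero.2 (Ne.symm hne))
  have hD : w - v = (a + b * cos ψ) • α + (b * sin ψ) • e := by
    rw [hvw, hβe]; module
  have heα : ⟪e, α⟫ = 0 := by rw [real_inner_comm]; exact hαe
  have hl2 : (a + b * cos ψ) ^ 2 + (b * sin ψ) ^ 2 = l ^ 2 := by
    rw [hl, ← real_inner_self_eq_norm_sq, hD]
    simp only [inner_add_left, inner_add_right, inner_smul_left, inner_smul_right, hαα, hee, hαe,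
      heα, conj_trivial]
    ring
  obtain ⟨τ, hτ0, hτπ, hc1, hs1⟩ := exists_polar hl0.le (by positivity) hl2
  have hτψ : τ ≤ ψ := by
    by_contra hlt
    push Not at hlt
    have : 0 < sin (τ - ψ) := sin_pos_of_pos_of_lt_pi (by linarith) (by linarith)
    have e1 : l * sin (τ - ψ) = - (a * sin ψ) := by
      rw [sin_sub]
      linear_combination (-cos ψ) * hs1 + sin ψ * hc1
    have : 0 < l * sin (τ - ψ) := by positivity
    have : 0 ≤ a * sin ψ := by positivity
    linarith
  have hscτ : sin τ ^ 2 + cos τ ^ 2 = 1 := sin_sq_add_cos_sq τ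
  have hD' : w = v + l • (cos τ • α + sin τ • e) := by
    rw [← sub_eq_iff_eq_add', hD, hc1, hs1]; module
  have hvd : cos τ * ⟪v, α⟫ + sin τ * ⟪v, e⟫ = - (l / 2) := by
    have h1 : ⟪w, w⟫ = ⟪v, v⟫ := by
      rw [real_inner_self_eq_norm_sq, real_inner_self_eq_norm_sq, hv, hw]
    rw [hD'] at h1
    simp only [inner_add_left, inner_add_right, inner_smul_left, inner_smul_right, hαα, hee, hαe,
      heα, conj_trivial, real_inner_comm v α, real_inner_comm v e] at h1
    have h2 : l * (2 * (cos τ * ⟪v, α⟫ + sin τ * ⟪v, e⟫) + l) = 0 := by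
      linear_combination h1 - l ^ 2 * hscτ
    rcases mul_eq_zero.1 h2 with h | h <;> linarith
  -- Seen from the centre of the circle, `v` has coordinate `s` across the chord and `-l / 2` along
  -- it.
  set s := sin τ * ⟪v, α⟫ - cos τ * ⟪v, e⟫ with hs
  obtain ⟨h, hh0, hhπ, hc2, hs2⟩ := exists_polar (x := s) (y := l / 2) (ρ := √(s ^ 2 + (l / 2) ^ 2))
    (sqrt_nonneg _) (by positivity) (by rw [sq_sqrt (by positivity)])
  set ρ := √(s ^ 2 + (l / 2) ^ 2) with hρ
  have hρ2 : ρ ^ 2 = s ^ 2 + (l / 2) ^ 2 := sq_sqrt (by positivity)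
  have hρ0 : 0 ≤ ρ := sqrt_nonneg _
  obtain ⟨c, hc⟩ : ∃ c, v = c + (s • (sin τ • α - cos τ • e) - (l / 2) • (cos τ • α + sin τ • e)) :=
    ⟨_, (sub_add_cancel _ _).symm⟩
  have hvα : ⟪v, α⟫ = sin τ * s - cos τ * (l / 2) := by
    rw [hs]; linear_combination (-⟪v, α⟫) * hscτ + cos τ * hvd
  have hve : ⟪v, e⟫ = - cos τ * s - sin τ * (l / 2) := by
    rw [hs]; linear_combination (-⟪v, e⟫) * hscτ + sin τ * hvd
  have hcα : ⟪c, α⟫ = 0 := by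
    rw [hc] at hvα
    simp only [inner_add_left, inner_sub_left, inner_smul_left, hαα, heα, conj_trivial] at hvα
    linarith
  have hce : ⟪c, e⟫ = 0 := by
    rw [hc] at hve
    simp only [inner_add_left, inner_sub_left, inner_smul_left, hee, hαe, conj_trivial] at hve
    linarith
  have hαc : ⟪α, c⟫ = 0 := by rw [real_inner_comm]; exact hcα
  have hec : ⟪e, c⟫ = 0 := by rw [real_inner_comm]; exact hce
  have hc1' : ⟪c, c⟫ + ρ ^ 2 = 1 := by
    have h1 : ⟪v, v⟫ = 1 := by rw [real_inner_self_eq_norm_sq, hv]; norm_num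
    rw [hc] at h1
    simp only [inner_add_left, inner_add_right, inner_sub_left, inner_sub_right, inner_smul_left,
      inner_smul_right, hαα, hee, hαe, heα, conj_trivial, hcα, hce, hαc, hec] at h1
    rw [hρ2]
    linear_combination h1 - (s ^ 2 + (l / 2) ^ 2) * hscτ
  have hball : ∀ φ : ℝ, ‖c + ρ • (sin φ • α - cos φ • e)‖ ≤ 1 := by
    intro φ
    rw [← sq_le_one_iff₀ (norm_nonneg _), ← real_inner_self_eq_norm_sq]
    simp only [inner_add_left, inner_add_right, inner_sub_left, inner_sub_right, inner_smul_left,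
      inner_smul_right, hαα, hee, hαe, heα, conj_trivial, hcα, hce, hαc, hec]
    have := sin_sq_add_cos_sq φ
    apply le_of_eq
    linear_combination hc1' + ρ ^ 2 * this
  have hvP : v = c + ρ • (sin (τ - h) • α - cos (τ - h) • e) := by
    rw [hc, sin_sub, cos_sub, hc2, hs2]; module
  have hwP : w = c + ρ • (sin (τ + h) • α - cos (τ + h) • e) := by
    have : l = 2 * (ρ * sin h) := by linarith
    rw [hD', hc, sin_add, cos_add, hc2, hs2, this]; module
  by_cases hτh : τ ≤ h
  · have := staircase_arc n α e c ρ 0 ψ τ h hρ0 hball h0 hπ hτ0 hτψ hτh hhπ (by linarith)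
    simp only [cos_zero, sin_zero, one_smul, zero_smul, add_zero, zero_add, ← hvP, ← hwP,
      ← hβe] at this
    exact this
  · push Not at hτh
    obtain _ | n := n
    · simp at hn; linarith [pi_pos]
    -- For h < τ the direction `α` leaves the ball at `v`: the first step has length zero, and the
    -- mirror image starts with `β`.
    refine ⟨0, le_rfl, by simp [hv], ?_⟩
    have flip : ∀ φ : ℝ, sin (π - φ) • α - cos (π - φ) • e =
        sin φ • α - cos φ • (-e) := by
      intro φ; rw [sin_pi_sub, cos_pi_sub]; module
    have := staircase_arc n α (-e) c ρ (-ψ) ψ (ψ - τ) (π - h) hρ0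
      (fun φ => by rw [← flip]; exact hball _) h0 hπ (by linarith) (by linarith) (by linarith)
      (by linarith) (by push_cast at hn; linarith)
    rw [← flip, ← flip] at this
    convert this using 1
    · rw [cos_neg, sin_neg, hβe]; module
    · simp
    · have : π - (-ψ + (ψ - τ) - (π - h)) = (τ - h) + 2 * π := by ring
      rw [this, sin_add_two_pi, cos_add_two_pi, zero_smul, add_zero, ← hvP]
    · have : π - (-ψ + (ψ - τ) + (π - h)) = τ + h := by ring
      rw [this, ← hwP]

end Staircase

/-! ### Lengths of broken lines and calibration -/

section Paths

variable {E : Type*} [NormedAddCommGroup E]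

/-- The length of the broken line which starts at `x`, goes through the points of the list in turn,
and ends at `y`. -/
def pathLen : E → List E → E → ℝ
  | x, [], y => dist x y
  | x, p :: ps, y => dist x p + pathLen p ps y

/-- Every broken line with successive vertices in the sets of the list `W` is at least as long as
some broken line with the same endpoints and a single vertex in `C`. -/
def Compresses (W : List (Set E)) (C : Set E) : Prop :=
  ∀ (x y : E) (ps : List E), List.Forall₂ (· ∈ ·) ps W →
    ∃ q ∈ C, dist x q + dist q y ≤ pathLen x ps y

/-- The list `X, Y, X, …` of length `n`. -/
def alternating {α : Type*} : ℕ → α → α → List α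
  | 0, _, _ => []
  | n + 1, X, Y => X :: alternating n Y X

theorem length_alternating {α : Type*} (n : ℕ) (X Y : α) : (alternating n X Y).length = n := by
  induction n generalizing X Y with
  | zero => rfl
  | succ n ih => simp [alternating, ih]

theorem mem_alternating {α : Type*} {n : ℕ} {X Y Z : α} (h : Z ∈ alternating n X Y) :
    Z = X ∨ Z = Y := by
  induction n generalizing X Y with
  | zero => simp [alternating] at h
  | succ n ih =>
    rcases List.mem_cons.1 h with h | h
    · exact .inl h
    · exact (ih h).symm

theorem dist_le_pathLen (x y : E) (ps : List E) : dist x y ≤ pathLen x ps y := by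
  induction ps generalizing x with
  | nil => exact le_rfl
  | cons p ps ih => exact (dist_triangle x p y).trans (by simpa [pathLen] using ih p)

variable [InnerProductSpace ℝ E]

theorem inner_sub_le_dist {v : E} (hv : ‖v‖ ≤ 1) (x y : E) : ⟪v, y - x⟫ ≤ dist x y := by
  rw [dist_comm, dist_eq_norm]
  calc ⟪v, y - x⟫ ≤ ‖v‖ * ‖y - x‖ := real_inner_le_norm _ _
    _ ≤ 1 * ‖y - x‖ := by gcongr
    _ = _ := one_mul _

/-- A segment paired with a vector of the unit ball gives at most its length. Changing the vector by
`c • a` at a vertex in `X` has a favourable sign, as `a` is normal to `X`. The sum telescopes. -/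
theorem Staircase.le_pathLen {n : ℕ} {a b v w z y : E} {X Y : Set E} (h : Staircase n a b v w)
    (hX : ∀ q ∈ X, ⟪a, q - z⟫ ≤ 0) (hY : ∀ q ∈ Y, ⟪b, q - z⟫ ≤ 0) (hv : ‖v‖ ≤ 1) (x : E)
    {ps : List E} (hps : List.Forall₂ (· ∈ ·) ps (alternating n X Y)) :
    ⟪w, y - z⟫ - ⟪v, x - z⟫ ≤ pathLen x ps y := by
  induction n generalizing a b v x X Y ps with
  | zero =>
    cases hps
    cases h
    have := inner_sub_le_dist hv x y
    rw [← inner_sub_right]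
    simpa [pathLen] using this
  | succ n ih =>
    obtain ⟨c, hc, hb, hst⟩ := h
    cases hps with
    | cons hp hps =>
      rename_i p ps
      have h1 := ih hst hY hX hb p hps
      have h2 := inner_sub_le_dist hv x p
      have h3 := mul_nonpos_of_nonneg_of_nonpos hc (hX p hp)
      have e : p - x = (p - z) - (x - z) := by abel
      rw [inner_add_left, inner_smul_left] at h1
      rw [e, inner_sub_right] at h2
      simp only [conj_trivial] at h1
      simp only [pathLen]
      linarith

end Paths

/-! ### Normal vectors of convex sets -/

section Normals

variable {E : Type*} [NormedAddCommGroup E] [InnerProductSpace ℝ E]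

/-- The strict hypograph of `⟪g, · - z⟫` over the interior of `X` misses `Y × [0, ∞)`; the slope of
a separating hyperplane provides the splitting. -/
theorem exists_add_normals [CompleteSpace E] {X Y : Set E} (hX : Convex ℝ X) (hY : Convex ℝ Y)
    {p z g : E} (hpX : p ∈ interior X) (hpY : p ∈ Y) (hzX : z ∈ X) (hzY : z ∈ Y)
    (hg : ∀ q ∈ X ∩ Y, ⟪g, q - z⟫ ≤ 0) :
    ∃ α β : E, g = α + β ∧ (∀ q ∈ X, ⟪α, q - z⟫ ≤ 0) ∧ ∀ q ∈ Y, ⟪β, q - z⟫ ≤ 0 := by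
  let K₁ : Set (E × ℝ) := {w | w.1 ∈ interior X ∧ w.2 < ⟪g, w.1 - z⟫}
  have hK₁o : IsOpen K₁ := (isOpen_interior.preimage continuous_fst).inter
    (isOpen_lt continuous_snd (by fun_prop))
  have hK₁c : Convex ℝ K₁ := by
    rintro ⟨w, s⟩ ⟨hw, hs⟩ ⟨w', s'⟩ ⟨hw', hs'⟩ a b ha hb hab
    refine ⟨hX.interior hw hw' ha hb hab, ?_⟩
    have e : a • w + b • w' - z = a • (w - z) + b • (w' - z) := by
      have : z = (a + b) • z := by rw [hab, one_smul]
      nth_rewrite 1 [this]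
      module
    simp only [Prod.fst_add, Prod.smul_fst, Prod.snd_add, Prod.smul_snd, smul_eq_mul] at *
    rw [e, inner_add_right, inner_smul_right, inner_smul_right]
    rcases ha.eq_or_lt with rfl | ha
    · have : b = 1 := by linarith
      subst this; linarith
    · have := mul_lt_mul_of_pos_left hs ha
      have := mul_le_mul_of_nonneg_left hs'.le hb
      linarith
  have hK₂c : Convex ℝ (Y ×ˢ Ici (0 : ℝ)) := hY.prod (convex_Ici 0)
  have hdisj : Disjoint K₁ (Y ×ˢ Ici (0 : ℝ)) := by
    rw [Set.disjoint_left]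
    rintro ⟨w, s⟩ ⟨hw, hs⟩ ⟨hw', hs'⟩
    have := hg w ⟨interior_subset hw, hw'⟩
    simp only [mem_Ici] at hs hs'
    linarith
  obtain ⟨f, u, hf₁, hf₂⟩ := geometric_hahn_banach_open hK₁c hK₁o hK₂c hdisj
  set c : ℝ := f (0, 1) with hc
  set b : E := (InnerProductSpace.toDual ℝ E).symm (f.comp (ContinuousLinearMap.inl ℝ E ℝ)) with hb
  have hfb : ∀ (w : E) (s : ℝ), f (w, s) = ⟪b, w⟫ + s * c := by
    intro w s
    have : ((w, s) : E × ℝ) = (w, 0) + s • (0, 1) := by simp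
    rw [this, map_add, map_smul, hb, InnerProductSpace.toDual_symm_apply]
    simp [hc]
  -- The hyperplane is not vertical because both sets have points over `p`.
  have hc0 : 0 < c := by
    have hp := hg p ⟨interior_subset hpX, hpY⟩
    have h1 := hf₁ (p, ⟪g, p - z⟫ - 1) ⟨hpX, by simp⟩
    have h2 := hf₂ (p, 0) ⟨hpY, by simp⟩
    rw [hfb] at h1 h2
    nlinarith
  have hint : ∀ w ∈ interior X, ⟪b, w⟫ + c * ⟪g, w - z⟫ ≤ u := by
    intro w hw
    have : ⟪g, w - z⟫ ≤ (u - ⟪b, w⟫) / c := by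
      refine le_of_forall_lt fun s hs => ?_
      have h1 := hf₁ (w, s) ⟨hw, hs⟩
      rw [hfb] at h1
      rw [lt_div_iff₀ hc0]; linarith
    rw [le_div_iff₀ hc0] at this
    linarith
  have hXu : ∀ w ∈ X, ⟪b, w⟫ + c * ⟪g, w - z⟫ ≤ u := by
    intro w hw
    have hcl : IsClosed {w : E | ⟪b, w⟫ + c * ⟪g, w - z⟫ ≤ u} :=
      isClosed_le (by fun_prop) continuous_const
    have hw' : w ∈ closure (interior X) := by
      rw [hX.closure_interior_eq_closure_of_nonempty_interior ⟨p, hpX⟩]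
      exact subset_closure hw
    exact closure_minimal hint hcl hw'
  have hYu : ∀ w ∈ Y, u ≤ ⟪b, w⟫ := by
    intro w hw
    have := hf₂ (w, 0) ⟨hw, by simp⟩
    rw [hfb] at this
    linarith
  refine ⟨g + c⁻¹ • b, -(c⁻¹ • b), by abel, fun q hq => ?_, fun q hq => ?_⟩
  · have h1 := hXu q hq
    have h2 := hYu z hzY
    rw [inner_add_left, inner_smul_left, inner_sub_right b]
    simp only [conj_trivial]
    have : ⟪g, q - z⟫ + c⁻¹ * (⟪b, q⟫ - ⟪b, z⟫) =
      c⁻¹ * (⟪b, q⟫ + c * ⟪g, q - z⟫ - ⟪b, z⟫) := by field_simp; ring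
    rw [this]
    exact mul_nonpos_of_nonneg_of_nonpos (by positivity) (by linarith)
  · have h1 := hXu z hzX
    have h2 := hYu q hq
    rw [sub_self, inner_zero_right, mul_zero, add_zero] at h1
    rw [inner_neg_left, inner_smul_left, inner_sub_right]
    simp only [conj_trivial]
    have := mul_nonneg (inv_pos.2 hc0).le (sub_nonneg.2 (h1.trans h2))
    linarith

theorem norm_sub_smul_le {a d : E} (ha : a ≠ 0) (t : ℝ) :
    ‖a - t • d‖ ≤ ‖a‖ - t * ⟪‖a‖⁻¹ • a, d⟫ + t ^ 2 * (‖d‖ ^ 2 / (2 * ‖a‖)) := by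
  have ha0 : 0 < ‖a‖ := norm_pos_iff.2 ha
  have h1 : ‖a - t • d‖ ^ 2 = ‖a‖ ^ 2 - 2 * (t * ⟪a, d⟫) + t ^ 2 * ‖d‖ ^ 2 := by
    rw [norm_sub_sq_real, inner_smul_right, norm_smul, mul_pow, Real.norm_eq_abs, sq_abs]
  have h2 : ‖a - t • d‖ ≤ (‖a - t • d‖ ^ 2 + ‖a‖ ^ 2) / (2 * ‖a‖) := by
    rw [le_div_iff₀ (by positivity)]
    nlinarith [sq_nonneg (‖a - t • d‖ - ‖a‖)]
  refine h2.trans (le_of_eq ?_)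
  rw [h1, inner_smul_left]
  simp only [conj_trivial]
  field_simp
  ring

/-- First variation of the length along the segment from `z` to `q`; the error is quadratic in `t`.
-/
theorem inner_le_zero_of_isMinOn {C : Set E} (hC : Convex ℝ C) {x y z : E} (hz : z ∈ C)
    (hmin : IsMinOn (fun q => dist x q + dist q y) C z) (hx : x ≠ z) (hy : y ≠ z) {q : E}
    (hq : q ∈ C) : ⟪‖x - z‖⁻¹ • (x - z) + ‖y - z‖⁻¹ • (y - z), q - z⟫ ≤ 0 := by
  by_contra! hpos
  set s := ⟪‖x - z‖⁻¹ • (x - z) + ‖y - z‖⁻¹ • (y - z), q - z⟫ with hs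
  set K := ‖q - z‖ ^ 2 / (2 * ‖x - z‖) + ‖q - z‖ ^ 2 / (2 * ‖y - z‖) with hK
  have hK0 : 0 ≤ K := by positivity
  have hle : ∀ t : ℝ, 0 < t → t ≤ 1 → s ≤ t * K := by
    intro t ht0 ht1
    have hm := hmin (hC hz hq (sub_nonneg.2 ht1) ht0.le (sub_add_cancel 1 t))
    have e : (1 - t) • z + t • q = z + t • (q - z) := by module
    simp only [mem_ofPred_eq] at hm
    rw [e, dist_comm _ y, dist_comm _ y, dist_eq_norm, dist_eq_norm, dist_eq_norm, dist_eq_norm,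
      ← sub_sub, ← sub_sub] at hm
    have h1 := norm_sub_smul_le (d := q - z) (sub_ne_zero.2 hx) t
    have h2 := norm_sub_smul_le (d := q - z) (sub_ne_zero.2 hy) t
    have h3 : t * s ≤ t * (t * K) := by
      rw [hs, hK, inner_add_left]
      linarith
    exact le_of_mul_le_mul_left h3 ht0
  have h1 := hle (min 1 (s / (2 * (K + 1)))) (by positivity) (min_le_left _ _)
  have h2 : min 1 (s / (2 * (K + 1))) * K ≤ s / (2 * (K + 1)) * K := by
    gcongr; exact min_le_right _ _
  have h3 : s / (2 * (K + 1)) * K ≤ s / 2 := by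
    rw [div_mul_eq_mul_div, div_le_div_iff₀ (by positivity) (by norm_num)]
    nlinarith
  linarith

open Real InnerProductGeometry in
-- Unless `α` itself serves, rotate `v` by `δ` towards `α`: the result makes an angle below π / 2
-- with `α`.
theorem exists_angle_le_inner_pos {v α : E} {δ : ℝ} (hv : v ≠ 0) (hα : α ≠ 0) (hδ : 0 < δ)
    (hδπ : δ ≤ π / 2) (h : angle v α < π / 2 + δ) :
    ∃ u : E, u ≠ 0 ∧ angle v u ≤ δ ∧ 0 < ⟪α, u⟫ := by
  by_cases hle : angle v α ≤ δ
  · exact ⟨α, hα, hle, real_inner_self_pos.2 hα⟩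
  push Not at hle
  set τ := angle v α with hτ
  have hsτ : 0 < sin τ := sin_pos_of_pos_of_lt_pi (by linarith) (by linarith)
  have hv0 : 0 < ‖v‖ := norm_pos_iff.2 hv
  have hα0 : 0 < ‖α‖ := norm_pos_iff.2 hα
  set v' := ‖v‖⁻¹ • v with hv'
  set α' := ‖α‖⁻¹ • α with hα'
  have hv1 : ‖v'‖ = 1 := norm_smul_inv_norm hv
  have hα1 : ‖α'‖ = 1 := norm_smul_inv_norm hα
  have hvv : ⟪v', v'⟫ = 1 := by rw [real_inner_self_eq_norm_sq, hv1]; norm_num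
  have hαα : ⟪α', α'⟫ = 1 := by rw [real_inner_self_eq_norm_sq, hα1]; norm_num
  have hang : ∀ x : E, angle v x = angle v' x := fun x =>
    (angle_smul_left_of_pos _ _ (inv_pos.2 hv0)).symm
  have hvα : ⟪v', α'⟫ = cos τ := by
    rw [hτ, hang, ← angle_smul_right_of_pos _ _ (inv_pos.2 hα0), cos_angle, hv1, ← hα', hα1]
    simp
  clear_value v' α'
  have hαv : ⟪α', v'⟫ = cos τ := by rw [real_inner_comm, hvα]
  have hsc := sin_sq_add_cos_sq τ
  set e := (sin τ)⁻¹ • (α' - cos τ • v') with he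
  clear_value e
  have hve : ⟪v', e⟫ = 0 := by
    rw [he, inner_smul_right, inner_sub_right, inner_smul_right, hvα, hvv]; ring
  have hev : ⟪e, v'⟫ = 0 := by rw [real_inner_comm, hve]
  have hαe : ⟪α', e⟫ = sin τ := by
    rw [he, inner_smul_right, inner_sub_right, inner_smul_right, hαv, hαα]
    field_simp; linarith
  have hee : ⟪e, e⟫ = 1 := by
    nth_rewrite 1 [he]
    rw [inner_smul_left, inner_sub_left, inner_smul_left, hve, hαe]
    simp [hsτ.ne']
  have hu : ‖cos δ • v' + sin δ • e‖ = 1 := by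
    rw [← sq_eq_sq₀ (norm_nonneg _) zero_le_one, ← real_inner_self_eq_norm_sq]
    simp only [inner_add_left, inner_add_right, inner_smul_left, inner_smul_right, hvv, hve, hev,
      hee, conj_trivial]
    have := sin_sq_add_cos_sq δ
    linarith
  refine ⟨cos δ • v' + sin δ • e, fun h0 => by simp [h0] at hu, ?_, ?_⟩
  · rw [hang, angle, hu, hv1, inner_add_right, inner_smul_right, inner_smul_right, hvv, hve]
    simp only [mul_one, mul_zero, add_zero, div_one]
    rw [arccos_cos hδ.le (by linarith)]
  · have hα2 : α = ‖α‖ • α' := by rw [hα', smul_smul, mul_inv_cancel₀ hα0.ne', one_smul]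
    rw [hα2, inner_smul_left, inner_add_right, inner_smul_right, inner_smul_right, hαv, hαe]
    have : 0 < cos (τ - δ) := cos_pos_of_mem_Ioo ⟨by linarith, by linarith⟩
    rw [cos_sub] at this
    simp only [conj_trivial]
    have h2 : cos δ * cos τ + sin δ * sin τ = cos τ * cos δ + sin τ * sin δ := by ring
    rw [h2]
    positivity

end Normals

/-! ### Compression for two walls -/

section TwoSets

variable {m : ℕ}

theorem HasWideCorners.mono {ε ε' : ℝ} {A : Set (Euc m)} (h : HasWideCorners ε A) (hε : ε' ≤ ε) :
    HasWideCorners ε' A := by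
  intro p hp
  obtain ⟨v, hv, r, hr, hs⟩ := h p hp
  refine ⟨v, hv, r, hr, Subset.trans ?_ hs⟩
  rintro x (hx | ⟨h1, h2⟩)
  · exact .inl hx
  · exact .inr ⟨h1, by linarith⟩

open Real InnerProductGeometry in
theorem le_angle_of_rightCircularCone_subset {C : Set (Euc m)} {z v α : Euc m} {ε r : ℝ}
    (hv : v ≠ 0) (hr : 0 < r) (hcone : rightCircularCone z v ε r ⊆ C) (hε : 0 < ε) (hεπ : ε ≤ π)
    (hα0 : α ≠ 0) (hα : ∀ q ∈ C, ⟪α, q - z⟫ ≤ 0) : π / 2 + ε / 2 ≤ angle v α := by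
  by_contra! hlt
  obtain ⟨u, hu, hvu, hpos⟩ := exists_angle_le_inner_pos hv hα0 (half_pos hε) (by linarith) hlt
  have hu0 : 0 < ‖u‖ := norm_pos_iff.2 hu
  have hk : 0 < r / ‖u‖ := by positivity
  have := hα (z + (r / ‖u‖) • u) (hcone (.inr ⟨?_, ?_⟩))
  · rw [add_sub_cancel_left, inner_smul_right] at this
    have := mul_pos hk hpos
    linarith
  · rw [dist_eq_norm, add_sub_cancel_left, norm_smul, Real.norm_eq_abs, abs_of_pos hk,
      div_mul_cancel₀ _ hu0.ne']
  · rw [add_sub_cancel_left, angle_smul_right_of_pos _ _ hk]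
    exact hvu

theorem exists_isMinOn_dist_add_dist {C : Set (Euc m)} (hC : IsClosed C) (hne : C.Nonempty)
    (x y : Euc m) : ∃ z ∈ C, IsMinOn (fun q => dist x q + dist q y) C z := by
  obtain ⟨p, hp⟩ := hne
  refine ContinuousOn.exists_isMinOn' (by fun_prop) hC hp (Filter.Eventually.filter_mono inf_le_left ?_)
  have : Tendsto (fun q => dist x q) (cocompact (Euc m)) atTop := by
    simpa only [dist_comm] using tendsto_dist_right_cocompact_atTop x
  filter_upwards [this.eventually_ge_atTop (dist x p + dist p y)] with q hq
  exact hq.trans (le_add_of_nonneg_right dist_nonneg)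

open Real InnerProductGeometry in
theorem compresses_alternating {ε : ℝ} (hε : 0 < ε) (hεπ : ε ≤ π) {X Y : Set (Euc m)}
    (hXc : IsClosed X) (hX : Convex ℝ X) (hYc : IsClosed Y) (hY : Convex ℝ Y) {p : Euc m}
    (hpX : p ∈ interior X) (hpY : p ∈ interior Y) (hXY : HasWideCorners ε (X ∩ Y)) :
    Compresses (alternating (⌈π / ε⌉₊ + 1) X Y) (X ∩ Y) := by
  intro x y ps hps
  by_cases hx : x ∈ X ∩ Y
  · exact ⟨x, hx, by simpa using dist_le_pathLen x y ps⟩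
  by_cases hy : y ∈ X ∩ Y
  · exact ⟨y, hy, by simpa using dist_le_pathLen x y ps⟩
  obtain ⟨z, hz, hmin⟩ := exists_isMinOn_dist_add_dist (hXc.inter hYc)
    ⟨p, interior_subset hpX, interior_subset hpY⟩ x y
  refine ⟨z, hz, ?_⟩
  have hxz : x ≠ z := fun h => hx (h ▸ hz)
  have hyz : y ≠ z := fun h => hy (h ▸ hz)
  obtain ⟨α, β, hαβ, hα, hβ⟩ := exists_add_normals hX hY hpX (interior_subset hpY) hz.1 hz.2
    (fun q hq => inner_le_zero_of_isMinOn (hX.inter hY) hz hmin hxz hyz hq)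
  set ξ := ‖x - z‖⁻¹ • (x - z) with hξ
  set η := ‖y - z‖⁻¹ • (y - z) with hη
  have hξ1 : ‖ξ‖ = 1 := norm_smul_inv_norm (sub_ne_zero.2 hxz)
  have hη1 : ‖η‖ = 1 := norm_smul_inv_norm (sub_ne_zero.2 hyz)
  have hn : π ≤ ⌈π / ε⌉₊ * ε := by
    rw [← div_le_iff₀ hε]; exact Nat.le_ceil _
  obtain ⟨k, hk⟩ : ∃ k, ⌈π / ε⌉₊ = k + 1 :=
    Nat.exists_eq_add_one.2 (Nat.ceil_pos.2 (by positivity))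
  have hst : Staircase (⌈π / ε⌉₊ + 1) α β (-ξ) η := by
    have hη' : η = -ξ + (α + β) := by rw [← hαβ]; abel
    by_cases hα0 : α = 0
    · rw [hk, hη', hα0]
      exact ⟨0, le_rfl, by simpa using hξ1.le, 1, zero_le_one,
        by simpa [hα0, ← hη'] using by rw [hα0, zero_add] at hη'; rw [← hη']; exact hη1.le,
        by
          rw [hα0, zero_add] at hη'
          simpa using Staircase.refl _ _ _ (by rw [← hη']; exact hη1.le)⟩
    by_cases hβ0 : β = 0
    · rw [hβ0, add_zero] at hη'
      refine ⟨1, zero_le_one, ?_, ?_⟩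
      · rw [one_smul, ← hη']; exact hη1.le
      · rw [one_smul, ← hη']; exact Staircase.refl _ _ _ hη1.le
    -- Each normal makes an angle of at least π / 2 + ε / 2 with the axis `v`, hence at most π / 2 -
    -- ε / 2 with `-v`.
    have hle : angle α β ≤ π - ε := by
      obtain ⟨v, hv, r, hr, hcone⟩ := hXY z hz
      have h1 := le_angle_of_rightCircularCone_subset hv hr hcone hε hεπ hα0
        (fun q hq => hα q hq.1)
      have h2 := le_angle_of_rightCircularCone_subset hv hr hcone hε hεπ hβ0
        (fun q hq => hβ q hq.2)
      have h3 := angle_le_angle_add_angle α (-v) β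
      rw [angle_neg_right, angle_neg_left, angle_comm α v] at h3
      linarith
    rcases (angle_nonneg α β).eq_or_lt with h0 | h0
    · obtain ⟨-, s, hs, rfl⟩ := angle_eq_zero_iff.1 h0.symm
      have e : -ξ + (1 + s) • α = η := by rw [hη']; module
      refine ⟨1 + s, by positivity, ?_, ?_⟩
      · rw [e]; exact hη1.le
      · rw [e]; exact Staircase.refl _ _ _ hη1.le
    have hαn : 0 < ‖α‖ := norm_pos_iff.2 hα0
    have hβn : 0 < ‖β‖ := norm_pos_iff.2 hβ0
    have hang : angle (‖α‖⁻¹ • α) (‖β‖⁻¹ • β) = angle α β := by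
      rw [angle_smul_left_of_pos _ _ (inv_pos.2 hαn), angle_smul_right_of_pos _ _ (inv_pos.2 hβn)]
    refine Staircase.smul (inv_pos.2 hαn) (inv_pos.2 hβn) ?_
    refine exists_staircase (a := ‖α‖) (b := ‖β‖) (norm_smul_inv_norm hα0) (norm_smul_inv_norm hβ0)
      (by rw [norm_neg, hξ1]) hη1 hαn.le hβn.le ?_ ?_ ?_ ?_
    · rw [smul_smul, smul_smul, mul_inv_cancel₀ hαn.ne', mul_inv_cancel₀ hβn.ne', one_smul,
        one_smul, hη']
    · rw [hang]; exact h0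
    · rw [hang]; linarith
    · rw [hang]
      refine hn.trans ?_
      gcongr
      linarith
  have := hst.le_pathLen (y := y) hα hβ (by rw [norm_neg, hξ1]) x hps
  have unit : ∀ a : Euc m, a ≠ 0 → ⟪‖a‖⁻¹ • a, a⟫ = ‖a‖ := by
    intro a ha
    have : ‖a‖ ≠ 0 := norm_ne_zero_iff.2 ha
    rw [inner_smul_left, real_inner_self_eq_norm_sq]
    simp only [conj_trivial]
    field_simp
  rw [inner_neg_left, hξ, hη, unit _ (sub_ne_zero.2 hxz), unit _ (sub_ne_zero.2 hyz)] at this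
  rw [dist_comm z y, dist_eq_norm, dist_eq_norm]
  linarith

end TwoSets

/-! ### Compressing words for several walls -/

section Words

variable {E : Type*} [NormedAddCommGroup E]

theorem pathLen_eq_dist_head_add (x y : E) (ps : List E) :
    pathLen x ps y = dist x (ps.headD y) + pathLen (ps.headD y) ps y := by
  cases ps <;> simp [pathLen]

theorem pathLen_append (x y : E) (ps qs : List E) :
    pathLen x (ps ++ qs) y = pathLen x ps (qs.headD y) + pathLen (qs.headD y) qs y := by
  induction ps generalizing x with
  | nil => exact pathLen_eq_dist_head_add x y qs
  | cons p ps ih => simp [pathLen, ih, add_assoc]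

theorem pathLen_le_dist_add (x x' y : E) (ps : List E) :
    pathLen x ps y ≤ dist x x' + pathLen x' ps y := by
  rw [pathLen_eq_dist_head_add x, pathLen_eq_dist_head_add x']
  linarith [dist_triangle x x' (ps.headD y)]

theorem compresses_singleton (Z : Set E) : Compresses [Z] Z := by
  intro x y ps hps
  cases hps with
  | cons hp hps =>
    cases hps
    exact ⟨_, hp, le_rfl⟩

/-- Each block of vertices is replaced by one vertex without lengthening the line; the first vertex
after the block, or `y`, serves as its far end point. -/
theorem Compresses.flatMap {W : List (Set E)} {f : Set E → List (Set E)} {D : Set E}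
    (h : Compresses W D) (hf : ∀ Z ∈ W, Compresses (f Z) Z) : Compresses (W.flatMap f) D := by
  intro x y ps hps
  suffices ∃ qs : List E, List.Forall₂ (· ∈ ·) qs W ∧ pathLen x qs y ≤ pathLen x ps y by
    obtain ⟨qs, hqs, hle⟩ := this
    obtain ⟨q, hq, hle'⟩ := h x y qs hqs
    exact ⟨q, hq, hle'.trans hle⟩
  clear h
  induction W generalizing x ps with
  | nil => exact ⟨ps, by simpa using hps, le_rfl⟩
  | cons Z W ih =>
    rw [List.flatMap_cons] at hps
    have h₁ := List.forall₂_take_append _ _ _ hps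
    have h₂ := List.forall₂_drop_append _ _ _ hps
    set ps₁ := List.take (f Z).length ps with hps₁
    set ps₂ := List.drop (f Z).length ps with hps₂
    have hsplit : ps = ps₁ ++ ps₂ := (List.take_append_drop _ _).symm
    obtain ⟨q, hq, hle⟩ := hf Z List.mem_cons_self x (ps₂.headD y) ps₁ h₁
    obtain ⟨qs, hqs, hle'⟩ := ih (fun Z' hZ' => hf Z' (List.mem_cons_of_mem _ hZ')) q ps₂ h₂
    refine ⟨q :: qs, .cons hq hqs, ?_⟩
    rw [hsplit, pathLen_append]
    rw [pathLen_eq_dist_head_add q y ps₂] at hle'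
    simp only [pathLen]
    linarith

variable {m : ℕ}

/-- A family of closed convex sets with a common interior point such that the intersections of its
subfamilies have `ε`-wide corners. -/
structure IsWideFamily (ε : ℝ) (L : Set (Set (Euc m))) : Prop where
  isClosed : ∀ Z ∈ L, IsClosed Z
  convex : ∀ Z ∈ L, Convex ℝ Z
  exists_mem_interior : ∃ p, ∀ Z ∈ L, p ∈ interior Z
  wide : ∀ S ⊆ L, HasWideCorners ε (⋂₀ S)

theorem IsWideFamily.merge {ε : ℝ} {X Y : Set (Euc m)} {L : Set (Set (Euc m))}
    (h : IsWideFamily ε (insert X (insert Y L))) : IsWideFamily ε (insert (X ∩ Y) L) := by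
  obtain ⟨p, hp⟩ := h.exists_mem_interior
  have hX : X ∈ insert X (insert Y L) := mem_insert _ _
  have hY : Y ∈ insert X (insert Y L) := mem_insert_of_mem _ (mem_insert _ _)
  have hL : ∀ Z ∈ L, Z ∈ insert X (insert Y L) := fun Z hZ =>
    mem_insert_of_mem _ (mem_insert_of_mem _ hZ)
  refine ⟨?_, ?_, ⟨p, ?_⟩, fun S hS => ?_⟩
  · rintro Z (rfl | hZ)
    · exact (h.isClosed X hX).inter (h.isClosed Y hY)
    · exact h.isClosed Z (hL Z hZ)
  · rintro Z (rfl | hZ)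
    · exact (h.convex X hX).inter (h.convex Y hY)
    · exact h.convex Z (hL Z hZ)
  · rintro Z (rfl | hZ)
    · rw [interior_inter]; exact ⟨hp X hX, hp Y hY⟩
    · exact hp Z (hL Z hZ)
  · by_cases hm : X ∩ Y ∈ S
    · have e : ⋂₀ S = ⋂₀ (insert X (insert Y (S ∩ L))) := by
        ext q
        simp only [mem_sInter, mem_insert_iff, forall_eq_or_imp, mem_inter_iff]
        constructor
        · intro hq
          exact ⟨(hq _ hm).1, (hq _ hm).2, fun Z hZ => hq Z hZ.1⟩
        · rintro ⟨h1, h2, h3⟩ Z hZ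
          rcases hS hZ with rfl | hZ'
          · exact ⟨h1, h2⟩
          · exact h3 Z ⟨hZ, hZ'⟩
      rw [e]
      exact h.wide _ (insert_subset_insert (insert_subset_insert inter_subset_right))
    · refine h.wide S fun Z hZ => ?_
      rcases hS hZ with rfl | hZ'
      · exact absurd hZ hm
      · exact hL Z hZ'

open Real in
-- Merging `X` and `Y` into `X ∩ Y` leaves one set fewer. In the word for the merged family, the
-- letter `X ∩ Y` is expanded into an alternating word, which multiplies the length by at most B.
theorem IsWideFamily.exists_compresses {ε : ℝ} (hε : 0 < ε) (hεπ : ε ≤ π) (L : List (Set (Euc m)))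
    (X : Set (Euc m)) (h : IsWideFamily ε {Z | Z ∈ X :: L}) :
    ∃ W : List (Set (Euc m)), (∀ Z ∈ W, Z ∈ X :: L) ∧
      W.length ≤ (⌈π / ε⌉₊ + 1) ^ L.length ∧ Compresses W (⋂₀ {Z | Z ∈ X :: L}) := by
  induction L generalizing X with
  | nil =>
    refine ⟨[X], fun Z hZ => hZ, by simp, ?_⟩
    have : ⋂₀ {Z | Z ∈ [X]} = X := by ext; simp
    rw [this]
    exact compresses_singleton X
  | cons Y L ih =>
    have e : {Z | Z ∈ X :: Y :: L} = insert X (insert Y {Z | Z ∈ L}) := by ext; simp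
    have e' : {Z | Z ∈ X ∩ Y :: L} = insert (X ∩ Y) {Z | Z ∈ L} := by ext; simp
    obtain ⟨W, hW, hlen, hc⟩ := ih (X ∩ Y) (by rw [e']; rw [e] at h; exact h.merge)
    have hX : X ∈ {Z | Z ∈ X :: Y :: L} := by simp
    have hY : Y ∈ {Z | Z ∈ X :: Y :: L} := by simp
    classical
    set f : Set (Euc m) → List (Set (Euc m)) := fun Z =>
      if Z = X ∩ Y then alternating (⌈π / ε⌉₊ + 1) X Y else [Z] with hf
    have hflen : ∀ Z, (f Z).length ≤ ⌈π / ε⌉₊ + 1 := by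
      intro Z
      simp only [hf]
      split_ifs <;> simp [length_alternating]
    refine ⟨W.flatMap f, ?_, ?_, ?_⟩
    · intro Z hZ
      obtain ⟨Z', hZ', hZ⟩ := List.mem_flatMap.1 hZ
      simp only [hf] at hZ
      split_ifs at hZ with heq
      · rcases mem_alternating hZ with rfl | rfl <;> simp
      · have h1 : Z = Z' := by simpa using hZ
        have h2 := hW Z' hZ'
        rw [List.mem_cons] at h2
        simp [h1, h2.resolve_left heq]
    · calc (W.flatMap f).length = (W.map fun Z => (f Z).length).sum := by
            rw [List.length_flatMap]
        _ ≤ (W.map fun Z => (f Z).length).length • (⌈π / ε⌉₊ + 1) :=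
            List.sum_le_card_nsmul _ _ (by simp only [List.mem_map]; rintro _ ⟨Z, -, rfl⟩; exact hflen Z)
        _ ≤ (⌈π / ε⌉₊ + 1) ^ L.length * (⌈π / ε⌉₊ + 1) := by
            rw [List.length_map, smul_eq_mul]; gcongr
        _ = _ := by rw [List.length_cons, pow_succ]
    · have e2 : ⋂₀ {Z | Z ∈ X :: Y :: L} = ⋂₀ {Z | Z ∈ X ∩ Y :: L} := by
        rw [e, e', sInter_insert, sInter_insert, sInter_insert, inter_assoc]
      rw [e2]
      refine hc.flatMap fun Z _ => ?_
      simp only [hf]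
      split_ifs with heq
      · rw [heq]
        obtain ⟨p, hp⟩ := h.exists_mem_interior
        refine compresses_alternating hε hεπ (h.isClosed X hX) (h.convex X hX) (h.isClosed Y hY)
          (h.convex Y hY) (hp X hX) (hp Y hY) ?_
        rw [← sInter_pair]
        exact h.wide _ (by rintro Z (rfl | rfl) <;> assumption)
      · exact compresses_singleton Z

end Words

/-! ### Chains of collisions -/

section Chains

/-- Each letter is found in its own block of `M` indices, and skipping vertices only shortens. Here
`a` starts the next block and `b` is the current vertex. -/
theorem exists_subsequence_pathLen_le {E ι : Type*} [NormedAddCommGroup E] {A : ι → Set E} {p : ℕ → E}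
    {w : ℕ → ι} {y : E} {N M : ℕ} {W : List (Set E)}
    (hmem : ∀ k ≤ N, p k ∈ A (w k))
    (hit : ∀ a, a + M ≤ N + 1 → ∀ Z ∈ W, ∃ k, a ≤ k ∧ k < a + M ∧ A (w k) = Z)
    {a b : ℕ} (hab : b ≤ a) (hb : b ≤ N) (ha : a + W.length * M ≤ N + 1) :
    ∃ ps : List E, List.Forall₂ (· ∈ ·) ps W ∧
      pathLen (p b) ps y ≤ ∑ i ∈ Finset.Ico b N, dist (p i) (p (i + 1)) + dist (p N) y := by
  induction W generalizing a b with
  | nil =>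
    refine ⟨[], .nil, ?_⟩
    have := dist_le_Ico_sum_dist p hb
    simp only [pathLen]
    linarith [dist_triangle (p b) (p N) y]
  | cons Z W ih =>
    rw [List.length_cons, add_mul, one_mul] at ha
    obtain ⟨k, hak, hka, hk⟩ := hit a (by omega) Z List.mem_cons_self
    obtain ⟨ps, hps, hle⟩ := ih (fun a ha Z hZ => hit a ha Z (List.mem_cons_of_mem _ hZ))
      (a := a + M) (b := k) hka.le (by omega) (by omega)
    refine ⟨p k :: ps, .cons (hk ▸ hmem k (by omega)) hps, ?_⟩
    have h1 := dist_le_Ico_sum_dist p (hab.trans hak)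
    have h2 := Finset.sum_Ico_consecutive (fun i => dist (p i) (p (i + 1))) (hab.trans hak)
      (show k ≤ N by omega)
    simp only [pathLen]
    linarith

variable {E : Type*} [NormedAddCommGroup E] [InnerProductSpace ℝ E] {ι : Type*}

/-- The record of `N` consecutive collisions: the `k`-th collision happens at the point `p k` of
the wall `A (w k)` and changes the velocity from `v k` to `v (k + 1)`. -/
structure IsCollisionChain (A : ι → Set E) (N : ℕ) (p v : ℕ → E) (w : ℕ → ι) : Prop where
  mem : ∀ k < N, p k ∈ A (w k)
  notMem : ∀ k < N, ∀ j, j ≠ w k → p k ∉ A j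
  norm_eq_one : ∀ k ≤ N, ‖v k‖ = 1
  ne : ∀ k < N, v k ≠ v (k + 1)
  inner_nonneg : ∀ k < N, ∀ q ∈ A (w k), 0 ≤ ⟪v k - v (k + 1), q - p k⟫
  straight : ∀ k, k + 1 < N → ∃ l : ℝ, 0 < l ∧ p (k + 1) = p k + l • v (k + 1)

variable {A : ι → Set E} {N : ℕ} {p v : ℕ → E} {w : ℕ → ι}

theorem IsCollisionChain.shift (h : IsCollisionChain A N p v w) {a M : ℕ} (ha : a + M ≤ N) :
    IsCollisionChain A M (fun k => p (a + k)) (fun k => v (a + k)) (fun k => w (a + k)) where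
  mem k hk := h.mem _ (by omega)
  notMem k hk := h.notMem _ (by omega)
  norm_eq_one k hk := h.norm_eq_one _ (by omega)
  ne k hk := h.ne _ (by omega)
  inner_nonneg k hk := h.inner_nonneg _ (by omega)
  straight k hk := h.straight (a + k) (by omega)

/-- Along a segment `⟪v, q - p⟫` falls by the distance travelled, and at a collision it does not
increase. The drop at the first collision is kept for the equality case. -/
theorem IsCollisionChain.sum_dist_le (h : IsCollisionChain A (N + 1) p v w) {q : E}
    (hq : ∀ k ≤ N, q ∈ A (w k)) {k : ℕ} (hk : k ≤ N) :
    ∑ i ∈ Finset.range k, dist (p i) (p (i + 1)) + ⟪v 0 - v 1, q - p 0⟫ ≤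
      ⟪v 0, q - p 0⟫ - ⟪v (k + 1), q - p k⟫ := by
  induction k with
  | zero => simp [inner_sub_left]
  | succ k ih =>
    obtain ⟨l, hl, hpl⟩ := h.straight k (by omega)
    have hv := h.norm_eq_one (k + 1) (by omega)
    have h1 := h.inner_nonneg (k + 1) (by omega) q (hq _ hk)
    have h2 : dist (p k) (p (k + 1)) = l := by
      rw [hpl, dist_eq_norm, sub_add_cancel_left, norm_neg, norm_smul, hv, mul_one,
        Real.norm_eq_abs, abs_of_pos hl]
    have h3 : ⟪v (k + 1), q - p (k + 1)⟫ = ⟪v (k + 1), q - p k⟫ - l := by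
      rw [hpl, ← sub_sub, inner_sub_right, inner_smul_right, real_inner_self_eq_norm_sq, hv]
      ring
    rw [inner_sub_left, h3] at h1
    rw [Finset.sum_range_succ, h2]
    linarith [ih (by omega)]

/-- A one-vertex broken line through a common point of the walls which is not longer than the
trajectory has its vertex at the first collision point. -/
theorem IsCollisionChain.eq_of_dist_add_dist_le (h : IsCollisionChain A (N + 1) p v w) {q : E}
    (hq : ∀ k ≤ N, q ∈ A (w k))
    (hle : dist (p 0 - v 0) q + dist q (p N + v (N + 1)) ≤
      1 + (∑ i ∈ Finset.range N, dist (p i) (p (i + 1)) + 1)) : q = p 0 := by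
  have hv0 := h.norm_eq_one 0 (by omega)
  have hv1 := h.norm_eq_one 1 (by omega)
  have hvN := h.norm_eq_one (N + 1) le_rfl
  have h0 := h.sum_dist_le hq le_rfl
  have h1 := inner_sub_le_dist hv0.le (p 0 - v 0) q
  have h2 := inner_sub_le_dist hvN.le q (p N + v (N + 1))
  have h3 := h.inner_nonneg 0 (by omega) q (hq 0 (by omega))
  have e1 : ⟪v 0, q - (p 0 - v 0)⟫ = ⟪v 0, q - p 0⟫ + 1 := by
    rw [← sub_add, inner_add_right, real_inner_self_eq_norm_sq, hv0]; norm_num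
  have e2 : ⟪v (N + 1), p N + v (N + 1) - q⟫ = 1 - ⟪v (N + 1), q - p N⟫ := by
    have : p N + v (N + 1) - q = v (N + 1) - (q - p N) := by abel
    rw [this, inner_sub_right, real_inner_self_eq_norm_sq, hvN]; norm_num
  rw [zero_add] at h3
  have e3 : ⟪v 0 - v 1, q - p 0⟫ = 0 := by linarith
  have e4 : ⟪v 0, q - (p 0 - v 0)⟫ = ‖v 0‖ * ‖q - (p 0 - v 0)‖ := by
    rw [hv0, one_mul, ← dist_eq_norm, dist_comm]
    linarith
  rw [inner_eq_norm_mul_iff_real, hv0, one_smul] at e4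
  set d := ‖q - (p 0 - v 0)‖
  -- Equality in Cauchy-Schwarz puts `q` on the incoming line; since `v 0 ≠ v 1`, the vanishing drop
  -- `e3` then leaves only `p 0`.
  have e5 : q - p 0 = (d - 1) • v 0 := by
    rw [sub_smul, e4, one_smul]; abel
  have hlt : ⟪v 1, v 0⟫ < 1 := (inner_lt_one_iff_real_of_norm_eq_one hv1 hv0).2
    (Ne.symm (h.ne 0 (by omega)))
  rw [e5, inner_smul_right, inner_sub_left, real_inner_self_eq_norm_sq, hv0] at e3
  rcases mul_eq_zero.1 e3 with hd | hd
  · rw [hd, zero_smul] at e5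
    exact sub_eq_zero.1 e5
  · linarith

/-- The outgoing ray leaves the half-space that contains the wall, so the same wall cannot be hit
again next. -/
theorem IsCollisionChain.lt_two (h : IsCollisionChain A N p v w) {i : ι} (hw : ∀ k < N, w k = i) :
    N < 2 := by
  by_contra! hN
  obtain ⟨l, hl, hpl⟩ := h.straight 0 (by omega)
  have h0 := h.inner_nonneg 0 (by omega) (p 1) (by
    have := h.mem 1 (by omega)
    rwa [hw 1 (by omega), ← hw 0 (by omega)] at this)
  rw [zero_add] at hpl h0
  have hv0 := h.norm_eq_one 0 (by omega)
  have hv1 := h.norm_eq_one 1 (by omega)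
  have hlt : ⟪v 0, v 1⟫ < 1 := (inner_lt_one_iff_real_of_norm_eq_one hv0 hv1).2 (h.ne 0 (by omega))
  rw [hpl, add_sub_cancel_left, inner_smul_right, inner_sub_left, real_inner_self_eq_norm_sq,
    hv1] at h0
  nlinarith

end Chains

open Real in
theorem IsCollisionChain.lt_pow {m : ℕ} {ι : Type*} {A : ι → Set (Euc m)} {ε : ℝ} (hε : 0 < ε)
    (hεπ : ε ≤ π) (hA : IsWideFamily ε (range A)) (s : ℕ) {N : ℕ} {p v : ℕ → Euc m} {w : ℕ → ι}
    (h : IsCollisionChain A N p v w) {S : Finset ι} (hS : S.card = s + 1)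
    (hw : ∀ k < N, w k ∈ S) : N < (⌈π / ε⌉₊ + 1) ^ ((s + 1) ^ 2) := by
  have hB : 2 ≤ ⌈π / ε⌉₊ + 1 := by
    have : 0 < ⌈π / ε⌉₊ := Nat.ceil_pos.2 (by positivity)
    omega
  set B := ⌈π / ε⌉₊ + 1 with hBdef
  induction s generalizing S N p v w with
  | zero =>
    obtain ⟨i, rfl⟩ := Finset.card_eq_one.1 hS
    have := h.lt_two (i := i) (fun k hk => by simpa using hw k hk)
    simpa using this.trans_le hB
  | succ s ih =>
    classical
    by_contra! hN
    have hBpos : 0 < B ^ ((s + 1 + 1) ^ 2) := by positivity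
    obtain ⟨N, rfl⟩ := Nat.exists_eq_add_one.2 (hBpos.trans_le hN)
    -- A block missing the wall `i` would be a chain on `S.erase i`, against the induction
    -- hypothesis.
    have hit : ∀ a, a + B ^ ((s + 1) ^ 2) ≤ N + 1 → ∀ i ∈ S,
        ∃ k, a ≤ k ∧ k < a + B ^ ((s + 1) ^ 2) ∧ w k = i := by
      intro a ha i hi
      by_contra! hno
      refine lt_irrefl _ (ih (h.shift ha) (S := S.erase i) ?_ ?_)
      · rw [Finset.card_erase_of_mem hi, hS]; rfl
      · intro k hk
        exact Finset.mem_erase.2 ⟨hno _ (by omega) (by omega), hw _ (by omega)⟩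
    obtain ⟨X, L, hL⟩ : ∃ X L, S.toList.map A = X :: L := by
      refine List.exists_cons_of_length_pos ?_
      rw [List.length_map, Finset.length_toList, hS]; omega
    have hmemL : ∀ Z, Z ∈ X :: L ↔ ∃ i ∈ S, A i = Z := by
      intro Z; rw [← hL]; simp
    have hLlen : L.length = s + 1 := by
      have := congrArg List.length hL
      rw [List.length_map, Finset.length_toList, hS, List.length_cons] at this
      omega
    have hsub : {Z | Z ∈ X :: L} ⊆ range A := by
      intro Z hZ
      obtain ⟨i, -, rfl⟩ := (hmemL Z).1 hZ
      exact mem_range_self i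
    have hfam : IsWideFamily ε {Z | Z ∈ X :: L} :=
      ⟨fun Z hZ => hA.isClosed Z (hsub hZ), fun Z hZ => hA.convex Z (hsub hZ),
        hA.exists_mem_interior.imp fun p hp Z hZ => hp Z (hsub hZ),
        fun T hT => hA.wide T (hT.trans hsub)⟩
    obtain ⟨W, hW, hWlen, hc⟩ := hfam.exists_compresses hε hεπ
    rw [← hBdef, hLlen] at hWlen
    obtain ⟨ps, hps, hle⟩ := exists_subsequence_pathLen_le (A := A) (w := w) (p := p) (N := N)
      (y := p N + v (N + 1)) (M := B ^ ((s + 1) ^ 2)) (W := W) (a := 0) (b := 0)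
      (fun k hk => h.mem k (by omega))
      (by
        intro a ha Z hZ
        obtain ⟨i, hi, rfl⟩ := (hmemL Z).1 (hW Z hZ)
        obtain ⟨k, h1, h2, rfl⟩ := hit a ha i hi
        exact ⟨k, h1, h2, rfl⟩)
      le_rfl (by omega)
      (by
        calc 0 + W.length * B ^ ((s + 1) ^ 2) ≤ B ^ (s + 1) * B ^ ((s + 1) ^ 2) := by
              rw [zero_add]; gcongr
          _ = B ^ (s + 1 + (s + 1) ^ 2) := by rw [pow_add B (s + 1)]
          _ ≤ B ^ ((s + 1 + 1) ^ 2) := Nat.pow_le_pow_right (by omega) (by nlinarith)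
          _ ≤ N + 1 := hN)
    obtain ⟨q, hq, hqle⟩ := hc (p 0 - v 0) (p N + v (N + 1)) ps hps
    have hqA : ∀ i ∈ S, q ∈ A i := fun i hi => hq _ ((hmemL _).2 ⟨i, hi, rfl⟩)
    have hq0 : q = p 0 := by
      refine h.eq_of_dist_add_dist_le (fun k hk => hqA _ (hw k (by omega))) ?_
      have h1 := pathLen_le_dist_add (p 0 - v 0) (p 0) (p N + v (N + 1)) ps
      have e1 : dist (p 0 - v 0) (p 0) = 1 := by
        rw [dist_eq_norm, sub_sub_cancel_left, norm_neg, h.norm_eq_one 0 (by omega)]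
      have e2 : dist (p N) (p N + v (N + 1)) = 1 := by
        rw [dist_eq_norm, sub_add_cancel_left, norm_neg, h.norm_eq_one _ le_rfl]
      rw [← Finset.range_eq_Ico] at hle
      linarith
    -- The first collision point would lie on a second wall.
    obtain ⟨i, hi, hne⟩ := Finset.exists_mem_ne (s := S) (by omega) (w 0)
    exact h.notMem 0 (by omega) i hne (hq0 ▸ hqA i hi)

variable {m : ℕ}

/-! ### The law of reflection at a convex wall -/

section Reflection

/-- The difference `u - K.reflection u` is orthogonal to the kernel of `f`, and `f` takes the value
`2 * f u ≤ 0` there, so it is a nonpositive multiple of the gradient of `f`. -/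
theorem inner_nonneg_of_reflection {K : Submodule ℝ (Euc m)} {f : Euc m →L[ℝ] ℝ}
    (hK : ∀ x, x ∈ K ↔ f x = 0) {u x : Euc m} (hu : f u ≤ 0) (hx : f x ≤ 0) :
    0 ≤ ⟪u - K.reflection u, x⟫ := by
  set d := u - K.reflection u with hd
  have hdK : d ∈ Kᗮ := by
    have : d = (2 : ℝ) • (u - K.starProjection u) := by
      rw [hd, Submodule.reflection_apply]; module
    rw [this]
    exact Submodule.smul_mem _ _ (Submodule.sub_starProjection_mem_orthogonal u)
  have hfd : f d = 2 * f u := by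
    have h1 : u + K.reflection u ∈ K := by
      have : u + K.reflection u = (2 : ℝ) • K.starProjection u := by
        rw [Submodule.reflection_apply]; module
      rw [this]
      exact Submodule.smul_mem _ _ (Submodule.starProjection_apply_mem _ _)
    rw [hK, map_add] at h1
    rw [hd, map_sub]; linarith
  by_cases hd0 : f d = 0
  · have : d = 0 := by
      have := Submodule.inner_right_of_mem_orthogonal ((hK d).2 hd0) hdK
      exact inner_self_eq_zero.1 this
    rw [this, inner_zero_left]
  have hneg : f d < 0 := lt_of_le_of_ne (by linarith) hd0
  have hmem : f d • x - f x • d ∈ K := by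
    rw [hK, map_sub, map_smul, map_smul, smul_eq_mul, smul_eq_mul]; ring
  have h0 := Submodule.inner_left_of_mem_orthogonal hmem hdK
  rw [inner_sub_right, inner_smul_right, inner_smul_right, real_inner_self_eq_norm_sq] at h0
  have := mul_nonpos_of_nonpos_of_nonneg hx (sq_nonneg ‖d‖)
  by_contra! hlt
  have := mul_pos_of_neg_of_neg hneg hlt
  linarith

/-- A hyperplane separating the interior of `A` from the segment just travelled supports `A` at `p`.
Its functional is maximal at `p` on the boundary, so by Lagrange multipliers its kernel is the
tangent hyperplane. -/
theorem IsReflectedAt.inner_nonneg {A : Set (Euc m)} (hAc : IsClosed A) (hA : Convex ℝ A)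
    (hne : (interior A).Nonempty) {p u v : Euc m} (h : IsReflectedAt (frontier A) p u v) {δ : ℝ}
    (hδ : 0 < δ) (hout : ∀ s, 0 < s → s ≤ δ → p - s • u ∉ interior A) {q : Euc m} (hq : q ∈ A) :
    0 ≤ ⟪u - v, q - p⟫ := by
  obtain ⟨hp, F, ⟨U, hU, hpU, hF, hF', hSU⟩, rfl⟩ := h
  have hdisj : Disjoint (interior A) (segment ℝ p (p - δ • u)) := by
    rw [Set.disjoint_right]
    intro x hx
    rw [segment_eq_image'] at hx
    obtain ⟨θ, ⟨h0, h1⟩, rfl⟩ := hx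
    have e : p + θ • (p - δ • u - p) = p - (θ * δ) • u := by module
    simp only [e]
    rcases h0.eq_or_lt with rfl | h0
    · simpa using hp.2
    · exact hout _ (by positivity) (by nlinarith)
  obtain ⟨f, c, hf₁, hf₂⟩ := geometric_hahn_banach_open hA.interior isOpen_interior
    (convex_segment _ _) hdisj
  have hAf : ∀ x ∈ A, f x ≤ c := by
    intro x hx
    have hx' : x ∈ closure (interior A) := by
      rw [hA.closure_interior_eq_closure_of_nonempty_interior hne]
      exact subset_closure hx
    exact closure_minimal (fun y hy => (hf₁ y hy).le)
      (isClosed_le f.continuous continuous_const : IsClosed {y | f y ≤ c}) hx'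
  have hpA : p ∈ A := hAc.frontier_subset hp
  have hcp : c ≤ f p := hf₂ p (left_mem_segment _ _ _)
  have hcu : c ≤ f (p - δ • u) := hf₂ _ (right_mem_segment _ _ _)
  have hfu : f u ≤ 0 := by
    rw [map_sub, map_smul, smul_eq_mul] at hcu
    have := hAf p hpA
    by_contra! hlt
    have := mul_pos hδ hlt
    linarith
  have hFp : F p = 0 := by
    have : p ∈ {x ∈ U | F x = 0} := hSU ▸ ⟨hp, hpU⟩
    exact this.2
  have hext : IsLocalExtrOn f {x | F x = F p} p := by
    right
    filter_upwards [mem_nhdsWithin_of_mem_nhds (hU.mem_nhds hpU), self_mem_nhdsWithin] with x hx hxF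
    have hx' : x ∈ frontier A ∩ U := by
      rw [hSU]
      exact ⟨hx, by rw [← hFp]; exact hxF⟩
    exact (hAf x (hAc.frontier_subset hx'.1)).trans hcp
  obtain ⟨a, b, hab, hlin⟩ := hext.exists_multipliers_of_hasStrictFDerivAt_1d
    ((hF.contDiffAt (hU.mem_nhds hpU)).hasStrictFDerivAt (by simp)) f.hasStrictFDerivAt
  have hlin' : ∀ x, a * fderiv ℝ F p x + b * f x = 0 := fun x => by
    simpa using congrArg (fun g : Euc m →L[ℝ] ℝ => g x) hlin
  have hb : b ≠ 0 := by
    rintro rfl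
    have ha : a ≠ 0 := by
      rintro rfl; exact hab rfl
    refine hF' (ContinuousLinearMap.ext fun x => ?_)
    simpa [ha] using hlin' x
  have ha : a ≠ 0 := by
    rintro rfl
    obtain ⟨y, hy⟩ := hne
    have h1 := hlin' y
    have h2 := hlin' p
    simp only [zero_mul, zero_add, mul_eq_zero, hb, false_or] at h1 h2
    have := hf₁ y hy
    linarith
  refine inner_nonneg_of_reflection (f := f) (fun x => ?_) hfu ?_
  · rw [LinearMap.mem_ker, ContinuousLinearMap.coe_coe]
    have := hlin' x
    constructor
    · intro h0
      rw [h0, mul_zero, zero_add] at this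
      exact (mul_eq_zero.1 this).resolve_left hb
    · intro h0
      rw [h0, mul_zero, add_zero] at this
      exact (mul_eq_zero.1 this).resolve_left ha
  · rw [map_sub]
    linarith [hAf q hq]

end Reflection

/-! ### Broken lines and their break points -/

section BrokenLines

variable {γ : ℝ → Euc m} {I : Set ℝ}

theorem HasVelocityBefore.unique {t : ℝ} {u u' : Euc m} (h : HasVelocityBefore γ t u)
    (h' : HasVelocityBefore γ t u') : u = u' := by
  obtain ⟨s, ⟨h1, h2⟩, hs⟩ := ((Eventually.and h h').and self_mem_nhdsWithin).exists
  have hs' : s - t ≠ 0 := sub_ne_zero.2 (ne_of_lt hs)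
  exact smul_right_injective _ hs' (add_left_cancel (h1.symm.trans h2))

theorem HasVelocityAfter.unique {t : ℝ} {u u' : Euc m} (h : HasVelocityAfter γ t u)
    (h' : HasVelocityAfter γ t u') : u = u' := by
  obtain ⟨s, ⟨h1, h2⟩, hs⟩ := ((Eventually.and h h').and self_mem_nhdsWithin).exists
  have hs' : s - t ≠ 0 := sub_ne_zero.2 (ne_of_gt hs)
  exact smul_right_injective _ hs' (add_left_cancel (h1.symm.trans h2))

theorem not_mem_collisionTimes_of_eventually {t s : ℝ} {u : Euc m}
    (h : ∀ᶠ r in 𝓝 s, γ r = γ t + (r - t) • u) : s ∉ collisionTimes γ I := by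
  rintro ⟨-, v, v', hv, hv', hne⟩
  have hs := h.self_of_nhds
  have h' : ∀ᶠ r in 𝓝 s, γ r = γ s + (r - s) • u := by
    filter_upwards [h] with r hr
    rw [hr, hs]; module
  exact hne ((hv.unique (h'.filter_mono nhdsWithin_le_nhds)).trans
    (hv'.unique (h'.filter_mono nhdsWithin_le_nhds)).symm)

theorem exists_lt_mem_of_mem_interior {t : ℝ} (ht : t ∈ interior I) : ∃ s ∈ I, s < t := by
  have h : ∀ᶠ s in 𝓝[<] t, s ∈ I := nhdsWithin_le_nhds (mem_interior_iff_mem_nhds.1 ht)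
  obtain ⟨s, h1, h2⟩ := (h.and self_mem_nhdsWithin).exists
  exact ⟨s, h1, h2⟩

theorem exists_gt_mem_of_mem_interior {t : ℝ} (ht : t ∈ interior I) : ∃ s ∈ I, t < s := by
  have h : ∀ᶠ s in 𝓝[>] t, s ∈ I := nhdsWithin_le_nhds (mem_interior_iff_mem_nhds.1 ht)
  obtain ⟨s, h1, h2⟩ := (h.and self_mem_nhdsWithin).exists
  exact ⟨s, h1, h2⟩

theorem IsUnitSpeedBrokenLine.norm_before (hγ : IsUnitSpeedBrokenLine γ I) {t : ℝ} {u : Euc m}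
    (ht : t ∈ interior I) (hu : HasVelocityBefore γ t u) : ‖u‖ = 1 := by
  obtain ⟨u', h1, h2⟩ := hγ.before t (interior_subset ht) (exists_lt_mem_of_mem_interior ht)
  rwa [hu.unique h2]

theorem IsUnitSpeedBrokenLine.norm_after (hγ : IsUnitSpeedBrokenLine γ I) {t : ℝ} {u : Euc m}
    (ht : t ∈ interior I) (hu : HasVelocityAfter γ t u) : ‖u‖ = 1 := by
  obtain ⟨u', h1, h2⟩ := hγ.after t (interior_subset ht) (exists_gt_mem_of_mem_interior ht)
  rwa [hu.unique h2]

/-- Collisions cannot accumulate at a time on whose two sides the curve is straight for a while. -/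
theorem IsUnitSpeedBrokenLine.finite_collisionTimes_inter_Icc (hγ : IsUnitSpeedBrokenLine γ I)
    {a b : ℝ} (ha : a ∈ I) (hb : b ∈ I) : (collisionTimes γ I ∩ Icc a b).Finite := by
  by_contra hinf
  obtain ⟨t, ht, hacc⟩ := Set.Infinite.exists_accPt_of_subset_isCompact hinf
    (isCompact_Icc (a := a) (b := b)) inter_subset_right
  rw [accPt_iff_frequently_nhdsNE] at hacc
  have htI : t ∈ I := hγ.ordConnected.out ha hb ht
  refine hacc ?_
  rw [← Iio_union_Ioi, nhdsWithin_union, eventually_sup]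
  constructor
  · by_cases h : ∃ s ∈ I, s < t
    · obtain ⟨u, -, hu⟩ := hγ.before t htI h
      filter_upwards [eventually_eventually_nhdsWithin.2 hu, self_mem_nhdsWithin] with s hs hst hm
      rw [isOpen_Iio.nhdsWithin_eq hst] at hs
      exact not_mem_collisionTimes_of_eventually hs hm.1
    · filter_upwards [self_mem_nhdsWithin] with s hst hm
      exact h ⟨s, interior_subset hm.1.1, hst⟩
  · by_cases h : ∃ s ∈ I, t < s
    · obtain ⟨u, -, hu⟩ := hγ.after t htI h
      filter_upwards [eventually_eventually_nhdsWithin.2 hu, self_mem_nhdsWithin] with s hs hst hm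
      rw [isOpen_Ioi.nhdsWithin_eq hst] at hs
      exact not_mem_collisionTimes_of_eventually hs hm.1
    · filter_upwards [self_mem_nhdsWithin] with s hst hm
      exact h ⟨s, interior_subset hm.1.1, hst⟩

/-- Between two consecutive collisions, the trajectory is straight. -/
theorem IsUnitSpeedBrokenLine.eq_add_smul (hγ : IsUnitSpeedBrokenLine γ I) {c d : ℝ} (hc : c ∈ I)
    (hd : d ∈ I) (hcd : c ≤ d) (hno : ∀ t ∈ Ioo c d, t ∉ collisionTimes γ I) {v : Euc m}
    (hv : HasVelocityAfter γ c v) : ∀ r ∈ Icc c d, γ r = γ c + (r - c) • v := by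
  have hIcc : Icc c d ⊆ I := hγ.ordConnected.out hc hd
  have hIoo : Ioo c d ⊆ interior I := interior_maximal (Ioo_subset_Icc_self.trans hIcc) isOpen_Ioo
  let S : Set ℝ := {t | ∀ r ∈ Icc c t, γ r = γ c + (r - c) • v}
  have hmem : ∀ t, t ∈ S ↔ ∀ r ∈ Icc c t, γ r = γ c + (r - c) • v := fun t => Iff.rfl
  have hcS : c ∈ S := by
    rintro r ⟨h1, h2⟩
    rw [le_antisymm h2 h1]; simp
  -- Continuous induction: the backward velocity gives continuity at the limit, and the absence of a
  -- collision lets `v` persist.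
  refine IsClosed.mem_of_ge_of_forall_exists_gt (s := S) ?_ hcS hcd ?_
  · refine isClosed_of_closure_subset fun t ht => ?_
    have htI : t ∈ Icc c d := by
      have := closure_mono (inter_subset_right (s := S) (t := Icc c d)) ht
      rwa [isClosed_Icc.closure_eq] at this
    refine ⟨fun r hr => ?_, htI⟩
    have hlt : ∀ r, c ≤ r → r < t → γ r = γ c + (r - c) • v := by
      intro r hcr hrt
      obtain ⟨s, hs, hsS, -⟩ := mem_closure_iff.1 ht (Ioi r) isOpen_Ioi hrt
      exact hsS r ⟨hcr, le_of_lt hs⟩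
    rcases hr.2.lt_or_eq with hrt | rfl
    · exact hlt r hr.1 hrt
    rcases hr.1.eq_or_lt with rfl | hcr
    · simp
    obtain ⟨u, -, hu⟩ := hγ.before r (hIcc htI) ⟨c, hc, hcr⟩
    have h1 : Tendsto (fun s : ℝ => γ r + (s - r) • u) (𝓝[<] r) (𝓝 (γ r + (r - r) • u)) :=
      Continuous.continuousWithinAt (by fun_prop)
    have h2 : Tendsto (fun s : ℝ => γ c + (s - c) • v) (𝓝[<] r) (𝓝 (γ c + (r - c) • v)) :=
      Continuous.continuousWithinAt (by fun_prop)
    have h3 : (fun s : ℝ => γ r + (s - r) • u) =ᶠ[𝓝[<] r] fun s => γ c + (s - c) • v := by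
      filter_upwards [hu, Ioo_mem_nhdsLT hcr] with s hs hs'
      rw [← hs, hlt s hs'.1.le hs'.2]
    simpa using tendsto_nhds_unique_of_eventuallyEq h1 h2 h3
  · rintro t ⟨htS, htc, htd⟩
    have ht := (hmem t).1 htS t ⟨htc, le_rfl⟩
    have hafter : HasVelocityAfter γ t v := by
      rcases htc.eq_or_lt with rfl | hct
      · exact hv
      obtain ⟨v', -, hv'⟩ := hγ.after t (hIcc ⟨htc, htd.le⟩) ⟨d, hd, htd⟩
      have hbefore : HasVelocityBefore γ t v := by
        filter_upwards [Ioo_mem_nhdsLT hct] with s hs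
        rw [htS s ⟨hs.1.le, hs.2.le⟩, ht]; module
      have : v = v' := by
        by_contra hne
        exact hno t ⟨hct, htd⟩ ⟨hIoo ⟨hct, htd⟩, v, v', hbefore, hv', hne⟩
      rwa [this]
    obtain ⟨e, he, hsub⟩ := mem_nhdsGT_iff_exists_Ioc_subset.1 hafter
    refine ⟨min e d, fun r hr => ?_, lt_min he htd, min_le_right _ _⟩
    rcases le_or_gt r t with hrt | hrt
    · exact htS r ⟨hr.1, hrt⟩
    · have h1 : γ r = γ t + (r - t) • v := hsub ⟨hrt, hr.2.trans (min_le_left _ _)⟩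
      rw [h1, ht]; module

end BrokenLines

/-! ### From trajectories to collision chains -/

theorem exists_enumeration {T : Set ℝ} (hT : T.Finite) : ∃ t : ℕ → ℝ, (∀ k < T.ncard, t k ∈ T) ∧
    ∀ k, k + 1 < T.ncard → t k < t (k + 1) ∧ ∀ s ∈ Ioo (t k) (t (k + 1)), s ∉ T := by
  have hcard : hT.toFinset.card = T.ncard := (ncard_eq_toFinset_card T hT).symm
  set e := hT.toFinset.orderEmbOfFin hcard with he
  refine ⟨fun k => if h : k < T.ncard then e ⟨k, h⟩ else 0, fun k hk => ?_, fun k hk => ?_⟩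
  · simp only [hk, dif_pos]
    exact hT.mem_toFinset.1 (Finset.orderEmbOfFin_mem _ hcard _)
  · have hk' : k < T.ncard := by omega
    simp only [hk, hk', dif_pos]
    refine ⟨e.strictMono (Fin.mk_lt_mk.2 (Nat.lt_succ_self k)), fun s hs hsT => ?_⟩
    have : s ∈ Set.range e := by
      rw [he, Finset.range_orderEmbOfFin]; exact hT.mem_toFinset.2 hsT
    obtain ⟨i, rfl⟩ := this
    have h1 := e.lt_iff_lt.1 hs.1
    have h2 := e.lt_iff_lt.1 hs.2
    rw [Fin.lt_def] at h1 h2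
    simp only at h1 h2
    omega

theorem table_subset_compl_interior {n : ℕ} (A : Fin n → Set (Euc m)) (i : Fin n) :
    table A ⊆ (interior (A i))ᶜ := by
  rw [← closure_compl]
  exact closure_mono (compl_subset_compl.2 (subset_iUnion A i))

theorem IsTrajectory.exists_isCollisionChain {n : ℕ} {A : Fin n → Set (Euc m)}
    (hclosed : ∀ i, IsClosed (A i)) (hconvex : ∀ i, Convex ℝ (A i))
    (hint : ∀ i, (interior (A i)).Nonempty) {γ : ℝ → Euc m} {I : Set ℝ} (hγ : IsTrajectory A γ I)
    {a b : ℝ} (ha : a ∈ collisionTimes γ I) (hb : b ∈ collisionTimes γ I) (hab : a ≤ b) :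
    ∃ (p v : ℕ → Euc m) (w : ℕ → Fin n),
      IsCollisionChain A (collisionTimes γ I ∩ Icc a b).ncard p v w := by
  have hsub : collisionTimes γ I ⊆ interior I := fun t ht => ht.1
  have hIcc : Icc a b ⊆ I :=
    hγ.brokenLine.ordConnected.out (interior_subset ha.1) (interior_subset hb.1)
  have hT : (collisionTimes γ I ∩ Icc a b).Finite :=
    hγ.brokenLine.finite_collisionTimes_inter_Icc (interior_subset ha.1) (interior_subset hb.1)
  obtain ⟨t, htT, htlt⟩ := exists_enumeration hT
  have hT0 : 0 < (collisionTimes γ I ∩ Icc a b).ncard :=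
    (ncard_pos hT).2 ⟨a, ha, le_rfl, hab⟩
  set N := (collisionTimes γ I ∩ Icc a b).ncard with hN
  have hvel : ∀ k, ∃ u v : Euc m, k < N →
      HasVelocityBefore γ (t k) u ∧ HasVelocityAfter γ (t k) v ∧ u ≠ v := by
    intro k
    by_cases hk : k < N
    · obtain ⟨-, u, v, h⟩ := (htT k hk).1
      exact ⟨u, v, fun _ => h⟩
    · exact ⟨0, 0, fun h => absurd h hk⟩
  choose U V hUV using hvel
  have hwall : ∀ k, ∃ i : Fin n, k < N → (∀ j, j ≠ i → γ (t k) ∉ A j) ∧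
      IsReflectedAt (frontier (A i)) (γ (t k)) (U k) (V k) := by
    intro k
    by_cases hk : k < N
    · obtain ⟨i, h1, h2⟩ := hγ.reflected _ (htT k hk).1
      exact ⟨i, fun _ => ⟨h1, h2 _ _ (hUV k hk).1 (hUV k hk).2.1⟩⟩
    -- Past the last collision any wall will do; that of the first one is at hand.
    · obtain ⟨i, -⟩ := hγ.reflected _ (htT 0 hT0).1
      exact ⟨i, fun h => absurd h hk⟩
  choose w hw using hwall
  have hstr : ∀ k, k + 1 < N → ∀ r ∈ Icc (t k) (t (k + 1)), γ r = γ (t k) + (r - t k) • V k := by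
    intro k hk
    have h0 := htT k (by omega)
    have h1 := htT (k + 1) hk
    refine hγ.brokenLine.eq_add_smul (interior_subset (hsub h0.1)) (interior_subset (hsub h1.1))
      (htlt k hk).1.le (fun s hs hsc => (htlt k hk).2 s hs ⟨hsc, ?_, ?_⟩) (hUV k (by omega)).2.1
    · exact h0.2.1.trans hs.1.le
    · exact hs.2.le.trans h1.2.2
  have hUV' : ∀ k, k + 1 < N → U (k + 1) = V k := by
    intro k hk
    refine (hUV (k + 1) hk).1.unique ?_
    have hlt := (htlt k hk).1
    filter_upwards [Ioo_mem_nhdsLT hlt] with s hs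
    rw [hstr k hk s ⟨hs.1.le, hs.2.le⟩, hstr k hk (t (k + 1)) ⟨hlt.le, le_rfl⟩]
    module
  set v : ℕ → Euc m := fun k => Nat.casesOn k (U 0) V with hv
  have hvU : ∀ k < N, v k = U k := by
    intro k hk
    cases k with
    | zero => rfl
    | succ k => exact (hUV' k hk).symm
  have hvV : ∀ k, v (k + 1) = V k := fun k => rfl
  refine ⟨fun k => γ (t k), v, w, ?_, ?_, ?_, ?_, ?_, ?_⟩
  · exact fun k hk => (hclosed _).frontier_subset (hw k hk).2.1
  · exact fun k hk => (hw k hk).1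
  · intro k hk
    cases k with
    | zero => exact hγ.brokenLine.norm_before (hsub (htT 0 hT0).1) (hUV 0 hT0).1
    | succ k => exact hγ.brokenLine.norm_after (hsub (htT k hk).1) (hUV k hk).2.1
  · intro k hk
    rw [hvU k hk, hvV]
    exact (hUV k hk).2.2
  · intro k hk q hq
    rw [hvU k hk, hvV]
    have hI : ∀ᶠ s in 𝓝[<] (t k), s ∈ I :=
      nhdsWithin_le_nhds (mem_interior_iff_mem_nhds.1 (hsub (htT k hk).1))
    obtain ⟨l, hl, hlsub⟩ := mem_nhdsLT_iff_exists_Ico_subset.1 ((hUV k hk).1.and hI)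
    refine (hw k hk).2.inner_nonneg (hclosed _) (hconvex _) (hint _) (sub_pos.2 hl) ?_ hq
    intro s hs0 hsl
    obtain ⟨h1, h2⟩ := hlsub (show t k - s ∈ Ico l (t k) from ⟨by linarith, by linarith⟩)
    have e : γ (t k) - s • U k = γ (t k - s) := by
      rw [h1]; module
    rw [e]
    exact table_subset_compl_interior A _ (hγ.mem_table _ h2)
  · intro k hk
    have hlt := (htlt k hk).1
    exact ⟨t (k + 1) - t k, sub_pos.2 hlt, hstr k hk _ ⟨hlt.le, le_rfl⟩⟩

theorem AllIntersectionsHaveWideCorners.isWideFamily {n : ℕ} {ε ε' : ℝ}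
    {A : Fin n → Set (Euc m)} (h : AllIntersectionsHaveWideCorners ε A) (hε : ε' ≤ ε)
    (hwall : ∀ i, IsConvexWall (A i)) (hint : ∃ p : Euc m, ∀ i, p ∈ interior (A i)) :
    IsWideFamily ε' (range A) where
  isClosed := by rintro _ ⟨i, rfl⟩; exact (hwall i).isClosed
  convex := by rintro _ ⟨i, rfl⟩; exact (hwall i).convex
  exists_mem_interior := by
    obtain ⟨p, hp⟩ := hint
    exact ⟨p, by rintro _ ⟨i, rfl⟩; exact hp i⟩
  wide S hS := by
    classical
    have e : ⋂₀ S = ⋂ i ∈ Finset.univ.filter (fun i => A i ∈ S), A i := by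
      ext q
      simp only [mem_sInter, mem_iInter, Finset.mem_filter, Finset.mem_univ, true_and]
      constructor
      · exact fun hq i hi => hq _ hi
      · intro hq Z hZ
        obtain ⟨i, rfl⟩ := hS hZ
        exact hq i hZ
    rw [e]
    exact (h _).mono hε

end Billiards

/-! ### The bound on the number of collisions -/

theorem mainTheorem2 (m n : ℕ) (ε : ℝ) (hε : 0 < ε)
    (A : Fin n → Set (Billiards.Euc m))
    (hwall : ∀ i, Billiards.IsConvexWall (A i))
    (hint : ∃ p : Billiards.Euc m, ∀ i, p ∈ interior (A i))
    (hwide : Billiards.AllIntersectionsHaveWideCorners ε A)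
    (γ : ℝ → Billiards.Euc m) (I : Set ℝ) (hγ : Billiards.IsTrajectory A γ I) :
    (Billiards.collisionTimes γ I).encard ≤ (((⌈Real.pi / ε⌉₊ + 1) ^ (n ^ 2) : ℕ) : ℕ∞) := by
  obtain _ | s := n
  · have : Billiards.collisionTimes γ I = ∅ := by
      refine Set.eq_empty_of_forall_notMem fun t ht => ?_
      obtain ⟨i, -⟩ := hγ.reflected t ht
      exact i.elim0
    rw [this, Set.encard_empty]
    exact zero_le
  by_contra! hlt
  -- Capping ε at π is harmless: for ε ≥ π both ceilings are 1.
  have hceil : ⌈Real.pi / min ε Real.pi⌉₊ = ⌈Real.pi / ε⌉₊ := by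
    rcases le_total ε Real.pi with h | h
    · rw [min_eq_left h]
    · rw [min_eq_right h, div_self Real.pi_pos.ne', Nat.ceil_one, eq_comm,
        Nat.ceil_eq_iff one_ne_zero]
      constructor
      · simpa using div_pos Real.pi_pos hε
      · simpa using (div_le_one hε).2 h
  -- There might be infinitely many collisions; finitely many of them, just enough for a
  -- contradiction, span a window `[a, b]` with a finite chain.
  obtain ⟨T, hTsub, hTcard⟩ := Set.exists_subset_encard_eq hlt.le
  have hTfin : T.Finite := Set.finite_of_encard_eq_coe hTcard
  have hTne : T.Nonempty := by
    rw [← Set.encard_ne_zero, hTcard]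
    exact_mod_cast (by positivity : (⌈Real.pi / ε⌉₊ + 1) ^ ((s + 1) ^ 2) ≠ 0)
  obtain ⟨a, haT, ha⟩ := Set.exists_min_image T id hTfin hTne
  obtain ⟨b, hbT, hb⟩ := Set.exists_max_image T id hTfin hTne

  obtain ⟨o, ho⟩ := hint
  obtain ⟨p, v, w, hchain⟩ := hγ.exists_isCollisionChain (fun i => (hwall i).isClosed)
    (fun i => (hwall i).convex) (fun i => ⟨o, ho i⟩) (hTsub haT) (hTsub hbT) (ha b hbT)
  have hbound := hchain.lt_pow (lt_min hε Real.pi_pos) (min_le_right _ _)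
    (hwide.isWideFamily (min_le_left _ _) hwall ⟨o, ho⟩) s (S := Finset.univ) (by simp)
    (fun k _ => Finset.mem_univ _)
  have hfin := hγ.brokenLine.finite_collisionTimes_inter_Icc
    (interior_subset (hTsub haT).1) (interior_subset (hTsub hbT).1)
  have hle : T.ncard ≤ (Billiards.collisionTimes γ I ∩ Icc a b).ncard :=
    Set.ncard_le_ncard (fun t ht => ⟨hTsub ht, ha t ht, hb t ht⟩) hfin
  rw [Set.ncard_def, hTcard, ENat.toNat_natCast] at hle
  rw [hceil] at hbound
  exact absurd hle (not_le.2 hbound)
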